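/- Let $K,M,N,d$ be natural numbers, $H_k\in\mathbb C^{N\times M}$ ($k=1,\dots,K$), $P>0$, $\sigma>0$, and let $\alpha_k\ge 0$ be user priorities. Let $\bar\alpha\ge\alpha_k$ and $\kappa\ge\|H_k\|_2^2$ for all $k$. For $U_k\in\mathbb C^{N\times d}$, $V_k\in\mathbb C^{M\times d}$ and Hermitian positive definite $W_k\in\mathbb C^{d\times d}$ put $\eta(V)=\sum_{m}\mathrm{Tr}(V_mV_m^H)$, $$E_k=(I-U_k^HH_kV_k)(I-U_k^HH_kV_k)^H+\sum_{m\ne k}U_k^HH_kV_mV_m^HH_k^HU_k+\frac{\eta(V)}{P}\sigma^2U_k^HU_k,$$ $$f(U,W,V)=\sum_{k=1}^K\alpha_k\{\mathrm{Tr}(W_kE_k)-\log\det W_k\}.$$ The matrix-inverse-free WMMSE algorithm with step sizes $\gamma_u,\gamma_v$ and positive integers $J_u,J_w,J_v$ starts from $U=0$, $W=I$ and any $V$ with $\eta(V)=P$. Each outer iteration performs 1. $J_u$ times, for all $k$: $U_k\leftarrow U_k-\gamma_u\nabla_uf(U_k)$, where $$\nabla_uf(U_k)=2\alpha_k\Big(-H_kV_k+\sum_mH_kV_mV_m^HH_k^HU_k\Big)W_k+\frac{2\alpha_k\sigma^2}{P}\eta(V)U_kW_k;$$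 2. $J_w$ times, for all $k$ (Schulz iteration): $W_k\leftarrow W_k(2I-E_kW_k)$; 3. $J_v$ times, for all $k$: $V_k\leftarrow V_k-\gamma_v\nabla_vf(V_k)$, where $$\nabla_vf(V_k)=\sum_m2\alpha_mH_m^HU_mW_mU_m^HH_mV_k-2\alpha_kH_k^HU_kW_k+2V_k\frac{\sigma^2}{P}\sum_m\alpha_m\mathrm{Tr}(W_mU_m^HU_m),$$ each such step being followed by the rescaling $V\leftarrow\beta V$, $U\leftarrow\frac1\beta U$ with $\beta=\sqrt{P/\eta(V)}$ (in the degenerate case $V=0$, where $\beta$ is undefined, the rescaling sets $U=0$, $V=0$). Let $\delta\approx1.68$ be the unique solution of $x-x^2-\log(2-x)=0$ with $1<x<2$, and define $$L_u=\frac{2\bar\alpha\delta(P\kappa+\sigma^2)^2}{\sigma^2},\qquad L_v=\frac{2\bar\alpha K\delta(P\kappa+d\sigma^2)}{P\sigma^2},$$ $$\nu_u=\frac{-L_d+\sqrt{L_d^2+4L_c\frac{\delta-1}{J_u+J_v}}}{2L_c},\quad L_c=\mu_u^2\frac{\delta(P\kappa+\sigma^2)^2}{\sigma^2},\quad L_d=2\mu_u\delta(P\kappa+\sigma^2)\frac{\sqrt{P\kappa}+\sqrt{P\kappa+\sigma^2}}{\sigma^2},$$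 $$\mu_u=2\bar\alpha\delta\sqrt{P\kappa+\sigma^2}\Big(1+\frac{P\kappa+\sqrt{P\kappa(P\kappa+\sigma^2)}}{\sigma^2}\Big),$$ $$\nu_v=\frac{-L_b+\sqrt{L_b^2+4L_a\frac{\delta-1}{J_u+J_v}}}{2L_a},\quad L_a=\frac{K\mu_v^2\delta(\kappa+\frac{d\sigma^2}{P})}{\sigma^2},\quad L_b=\frac{2K\sqrt P\mu_v\delta(\kappa+\frac{\sqrt d\sigma^2}{P})+2\mu_v\delta\sqrt{\kappa(P\kappa+\sigma^2)}}{\sigma^2},$$ $$\mu_v=2\bar\alpha\delta\frac{KP\kappa+\sqrt{P\kappa(P\kappa+\sigma^2)}+Kd\sigma^2}{\sqrt P\sigma^2}.$$ Theorem. If $0<\gamma_u\le\min(1/L_u,\nu_u)$ and $0<\gamma_v\le\min(1/L_v,\nu_v)$, then all $W_k$ generated by the algorithm are Hermitian positive definite (so $f$ is well defined along the algorithm), and the cost $f$ is monotonically non-increasing along the outer iterations. Moreover, $f$ does not increase in any individual update: in each single gradient step on $U$, each single Schulz iteration on $W$, each single gradient step on $V$, and each rescaling. -/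

import Mathlib

open scoped Matrix ComplexOrder Matrix.Norms.L2Operator

noncomputable section

namespace WMMSE

/-- Data of a MU-MIMO downlink: `K` users with `N` antennas each, `M` transmit antennas,
`d` streams per user, channels `H k`, priorities `α k`, transmit power `P`,
noise variance `σ ^ 2`. -/
structure Downlink (K M N d : ℕ) where
  H : Fin K → Matrix (Fin N) (Fin M) ℂ
  α : Fin K → ℝ
  P : ℝ
  σ : ℝ

/-- The optimization variables: receivers `U`, weights `W`, beamformers `V`. -/
@[ext] structure Vars (K M N d : ℕ) where
  U : Fin K → Matrix (Fin N) (Fin d) ℂ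
  W : Fin K → Matrix (Fin d) (Fin d) ℂ
  V : Fin K → Matrix (Fin M) (Fin d) ℂ

/-- Total transmit power `∑ₘ Tr (Vₘ Vₘᴴ)`. -/
def power {K M d : ℕ} (V : Fin K → Matrix (Fin M) (Fin d) ℂ) : ℝ :=
  ∑ m, (V m * (V m)ᴴ).trace.re

variable {K M N d : ℕ}

/-- The matrix `E k`: the MSE matrix of user `k`, with the noise variance multiplied by
`power V / P`. -/
def E (c : Downlink K M N d) (U : Fin K → Matrix (Fin N) (Fin d) ℂ)
    (V : Fin K → Matrix (Fin M) (Fin d) ℂ) (k : Fin K) : Matrix (Fin d) (Fin d) ℂ :=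
  (1 - (U k)ᴴ * c.H k * V k) * (1 - (U k)ᴴ * c.H k * V k)ᴴ
    + ∑ m ∈ Finset.univ.erase k, (U k)ᴴ * c.H k * V m * (V m)ᴴ * (c.H k)ᴴ * U k
    + (power V / c.P * c.σ ^ 2) • ((U k)ᴴ * U k)

/-- The cost `∑ₖ αₖ (Tr (Wₖ Eₖ) - log det Wₖ)`. (For Hermitian positive definite `Wₖ` the trace
and the determinant are real.) -/
def cost (c : Downlink K M N d) (x : Vars K M N d) : ℝ :=
  ∑ k, c.α k * ((x.W k * E c x.U x.V k).trace.re - Real.log (x.W k).det.re)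

/-- The gradient of the cost with respect to `U k`. -/
def gradU (c : Downlink K M N d) (x : Vars K M N d) (k : Fin K) : Matrix (Fin N) (Fin d) ℂ :=
  (2 * c.α k) • ((-(c.H k * x.V k)
      + (∑ m, c.H k * x.V m * (x.V m)ᴴ) * (c.H k)ᴴ * x.U k) * x.W k)
    + (2 * c.α k * c.σ ^ 2 / c.P * power x.V) • (x.U k * x.W k)

/-- The gradient of the cost with respect to `V k`. -/
def gradV (c : Downlink K M N d) (x : Vars K M N d) (k : Fin K) : Matrix (Fin M) (Fin d) ℂ :=
  (∑ m, (2 * c.α m) • ((c.H m)ᴴ * x.U m * x.W m * (x.U m)ᴴ * c.H m * x.V k))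
    - (2 * c.α k) • ((c.H k)ᴴ * x.U k * x.W k)
    + (2 * (c.σ ^ 2 / c.P * ∑ m, c.α m * (x.W m * (x.U m)ᴴ * x.U m).trace.re)) • x.V k

/-- One gradient step of size `γ` on `U`. -/
def stepU (c : Downlink K M N d) (γ : ℝ) (x : Vars K M N d) : Vars K M N d :=
  { x with U := fun k => x.U k - γ • gradU c x k }

/-- One Schulz iteration on `W`. -/
def stepW (c : Downlink K M N d) (x : Vars K M N d) : Vars K M N d :=
  { x with W := fun k => x.W k * ((2 : ℝ) • (1 : Matrix (Fin d) (Fin d) ℂ)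
      - E c x.U x.V k * x.W k) }

/-- One gradient step of size `γ` on `V`. -/
def stepV (c : Downlink K M N d) (γ : ℝ) (x : Vars K M N d) : Vars K M N d :=
  { x with V := fun k => x.V k - γ • gradV c x k }

/-- The factor `β = √(P / power V)`. -/
def scaleFactor (c : Downlink K M N d) (x : Vars K M N d) : ℝ :=
  √(c.P / power x.V)

/-- The reciprocal scaling `V ← β V`, `U ← β⁻¹ U`. In the degenerate case `V = 0`, where `β` is
not defined, it gives `U = 0` and `V = 0`, by the convention `1 / 0 = 0`. -/
def rescale (c : Downlink K M N d) (x : Vars K M N d) : Vars K M N d :=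
  { x with
    U := fun k => (1 / scaleFactor c x) • x.U k
    V := fun k => scaleFactor c x • x.V k }

/-- The initial point `U = 0`, `W = I` and `V = V₀`. -/
def init (V₀ : Fin K → Matrix (Fin M) (Fin d) ℂ) : Vars K M N d where
  U := fun _ => 0
  W := fun _ => 1
  V := V₀

/-- Step sizes and numbers of inner iterations. -/
structure Schedule where
  γu : ℝ
  γv : ℝ
  Ju : ℕ
  Jw : ℕ
  Jv : ℕ

/-- The state after `j` inner steps on `U`, in an outer iteration that starts at `x`. -/
def phaseU (c : Downlink K M N d) (s : Schedule) (x : Vars K M N d) (j : ℕ) : Vars K M N d :=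
  (stepU c s.γu)^[j] x

/-- The state after all `Ju` steps on `U` and `j` Schulz iterations on `W`. -/
def phaseW (c : Downlink K M N d) (s : Schedule) (x : Vars K M N d) (j : ℕ) : Vars K M N d :=
  (stepW c)^[j] (phaseU c s x s.Ju)

/-- The state after all `Ju` steps on `U`, all `Jw` Schulz iterations on `W`, and `j` steps on `V`,
each followed by the rescaling. -/
def phaseV (c : Downlink K M N d) (s : Schedule) (x : Vars K M N d) (j : ℕ) : Vars K M N d :=
  (fun y => rescale c (stepV c s.γv y))^[j] (phaseW c s x s.Jw)

/-- The iterates of the matrix-inverse-free WMMSE algorithm: the state after `l` outer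
iterations. -/
def iterate (c : Downlink K M N d) (s : Schedule) (V₀ : Fin K → Matrix (Fin M) (Fin d) ℂ) :
    ℕ → Vars K M N d
  | 0 => init V₀
  | l + 1 => phaseV c s (iterate c s V₀ l) s.Jv

/-! The step size constants; `a` stands for the bound on the priorities. -/

def Lu (P κ σ a δ : ℝ) : ℝ :=
  2 * a * δ * (P * κ + σ ^ 2) ^ 2 / σ ^ 2

def Lv (K d : ℕ) (P κ σ a δ : ℝ) : ℝ :=
  2 * a * K * δ * (P * κ + d * σ ^ 2) / (P * σ ^ 2)

def μu (P κ σ a δ : ℝ) : ℝ :=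
  2 * a * δ * √(P * κ + σ ^ 2)
    * (1 + (P * κ + √(P * κ * (P * κ + σ ^ 2))) / σ ^ 2)

def Lc (P κ σ a δ : ℝ) : ℝ :=
  μu P κ σ a δ ^ 2 * (δ * (P * κ + σ ^ 2) ^ 2 / σ ^ 2)

def Ld (P κ σ a δ : ℝ) : ℝ :=
  2 * μu P κ σ a δ * δ * (P * κ + σ ^ 2)
    * ((√(P * κ) + √(P * κ + σ ^ 2)) / σ ^ 2)

/-- `J` is the total number `Ju + Jv` of gradient steps in one outer iteration. -/
def νu (J : ℕ) (P κ σ a δ : ℝ) : ℝ :=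
  (-Ld P κ σ a δ + √(Ld P κ σ a δ ^ 2 + 4 * Lc P κ σ a δ * ((δ - 1) / J)))
    / (2 * Lc P κ σ a δ)

def μv (K d : ℕ) (P κ σ a δ : ℝ) : ℝ :=
  2 * a * δ * ((K * P * κ + √(P * κ * (P * κ + σ ^ 2)) + K * d * σ ^ 2) / (√P * σ ^ 2))

def La (K d : ℕ) (P κ σ a δ : ℝ) : ℝ :=
  K * μv K d P κ σ a δ ^ 2 * δ * (κ + d * σ ^ 2 / P) / σ ^ 2

def Lb (K d : ℕ) (P κ σ a δ : ℝ) : ℝ :=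
  (2 * K * √P * μv K d P κ σ a δ * δ * (κ + √d * σ ^ 2 / P)
    + 2 * μv K d P κ σ a δ * δ * √(κ * (P * κ + σ ^ 2))) / σ ^ 2

def νv (J K d : ℕ) (P κ σ a δ : ℝ) : ℝ :=
  (-Lb K d P κ σ a δ + √(Lb K d P κ σ a δ ^ 2 + 4 * La K d P κ σ a δ * ((δ - 1) / J)))
    / (2 * La K d P κ σ a δ)

end WMMSE

end

/-!
Why the cost decreases along the matrix-inverse-free WMMSE algorithm.

Write `W k = C Cᴴ` with `C` invertible. Everything is measured in the coordinates given by `C`: the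
algorithm keeps the eigenvalues of `Cᴴ E C` (those of `W E`) in `[0, δ]`; this is `Adm`.

*Schulz iterations.* An eigenvalue `t` of `W E` becomes `t (2 - t) ≤ 1`, so the bound is reset to
`1` (`Adm.schulz`), and the cost changes by `∑ (t - t² - log (2 - t))`, which is nonpositive for
`0 ≤ t ≤ δ` by the choice of `δ` (`Adm.schulz_cost_le`).

*Gradient steps.* While the power is `P`, the noise term of `E` and the lower bound
`E ≥ σ² / (P κ + σ²)` turn `Cᴴ E C ≤ δ` into bounds on `‖U C‖` and `‖C‖`
(`Params.factor_bounds`). These bound the gradients by `μu` and `μv`, the Hessians of the quadratic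
functions `U ↦ f` and `V ↦ f` by `Lu` and `Lv`, and the change of `Cᴴ E C` in one step by
`Lc γ² + Ld γ` and `La γ² + Lb γ`. The first condition on the step size gives descent, the second a
drift of the eigenvalues by at most `(δ - 1) / (Ju + Jv)` (`Params.stepU_user`,
`Params.stepV_spec`). Between two blocks of Schulz iterations there are `Ju + Jv` gradient steps,
so that the eigenvalues, at most `1` at the start, stay at most `δ`.

*Rescaling.* It leaves every `E k` unchanged and restores the power `P`. If `V` has become `0`, then
`E = I` before and after, and the state `U = 0`, `V = 0` is fixed by all further steps on `U`
and `V`.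
-/

noncomputable section

namespace WMMSE

/-! ### Operator norm and positive semidefiniteness -/

section Norms

variable {m n p : Type*} [Fintype m] [Fintype n] [Fintype p]

theorem norm_real_smul [DecidableEq n] (r : ℝ) (A : Matrix m n ℂ) : ‖r • A‖ = |r| * ‖A‖ := by
  have h : r • A = (r : ℂ) • A := by
    ext i j
    simp
  rw [h, norm_smul, Complex.norm_real, Real.norm_eq_abs]

open scoped MatrixOrder in
theorem posSemidef_smul_one_sub [DecidableEq n] {M : Matrix n n ℂ} (hM : M.IsHermitian)
    {r : ℝ} (h : ‖M‖ ≤ r) :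
    (r • (1 : Matrix n n ℂ) - M).PosSemidef := by
  have h1 : M ≤ algebraMap ℝ (Matrix n n ℂ) ‖M‖ := IsSelfAdjoint.le_algebraMap_norm_self hM
  have h2 : algebraMap ℝ (Matrix n n ℂ) ‖M‖ ≤ algebraMap ℝ (Matrix n n ℂ) r :=
    algebraMap_mono _ h
  have h3 := h1.trans h2
  rwa [Matrix.le_iff, Algebra.algebraMap_eq_smul_one] at h3

open scoped MatrixOrder in
theorem norm_sq_le_of_posSemidef [DecidableEq n] {A : Matrix m n ℂ} {r : ℝ} (hr : 0 ≤ r)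
    (h : (r • (1 : Matrix n n ℂ) - Aᴴ * A).PosSemidef) : ‖A‖ ^ 2 ≤ r := by
  rw [sq, ← Matrix.l2_opNorm_conjTranspose_mul_self,
    CStarAlgebra.norm_le_iff_le_algebraMap _ hr
      (Matrix.nonneg_iff_posSemidef.2 (Matrix.posSemidef_conjTranspose_mul_self A)),
    Matrix.le_iff, Algebra.algebraMap_eq_smul_one]
  exact h

theorem posSemidef_norm_sq_sub [DecidableEq n] (A : Matrix m n ℂ) :
    ((‖A‖ ^ 2) • (1 : Matrix n n ℂ) - Aᴴ * A).PosSemidef :=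
  posSemidef_smul_one_sub (Matrix.isHermitian_conjTranspose_mul_self A)
    (by rw [Matrix.l2_opNorm_conjTranspose_mul_self, sq])

theorem norm_mul₃_le {q : Type*} [Fintype q] [DecidableEq n] [DecidableEq p] [DecidableEq q]
    (A : Matrix m n ℂ) (B : Matrix n p ℂ) (C : Matrix p q ℂ) :
    ‖A * B * C‖ ≤ ‖A‖ * ‖B‖ * ‖C‖ :=
  (Matrix.l2_opNorm_mul _ _).trans
    (mul_le_mul_of_nonneg_right (Matrix.l2_opNorm_mul _ _) (norm_nonneg _))

theorem norm_self_mul_conjTranspose [DecidableEq m] [DecidableEq n] (A : Matrix m n ℂ) :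
    ‖A * Aᴴ‖ = ‖A‖ ^ 2 := by
  have := Matrix.l2_opNorm_conjTranspose_mul_self Aᴴ
  rw [Matrix.conjTranspose_conjTranspose, Matrix.l2_opNorm_conjTranspose] at this
  rw [this, sq]

/-! ### The real Frobenius inner product -/

/-- The real part `Re Tr (Aᴴ B)` of the Frobenius inner product: the real inner product for which
the gradients of the cost are taken. -/
def rip (A B : Matrix m n ℂ) : ℝ := (Aᴴ * B).trace.re

theorem rip_add_left (A B C : Matrix m n ℂ) : rip (A + B) C = rip A C + rip B C := by
  simp [rip, Matrix.add_mul]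

theorem rip_add_right (A B C : Matrix m n ℂ) : rip A (B + C) = rip A B + rip A C := by
  simp [rip, Matrix.mul_add]

theorem rip_smul_left (r : ℝ) (A B : Matrix m n ℂ) : rip (r • A) B = r * rip A B := by
  simp [rip, Matrix.conjTranspose_smul]

theorem rip_smul_right (r : ℝ) (A B : Matrix m n ℂ) : rip A (r • B) = r * rip A B := by
  simp [rip]

theorem trace_conjTranspose_re (A : Matrix n n ℂ) : Aᴴ.trace.re = A.trace.re := by
  simp [Matrix.trace_conjTranspose]

theorem rip_comm (A B : Matrix m n ℂ) : rip A B = rip B A := by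
  rw [rip, ← trace_conjTranspose_re, Matrix.conjTranspose_mul, Matrix.conjTranspose_conjTranspose,
    rip]

theorem rip_conjTranspose (A B : Matrix m n ℂ) : rip Aᴴ Bᴴ = rip A B := by
  rw [rip, Matrix.conjTranspose_conjTranspose, Matrix.trace_mul_comm, rip_comm, rip]

theorem rip_mul_left (A : Matrix m p ℂ) (B : Matrix p n ℂ) (C : Matrix m n ℂ) :
    rip (A * B) C = rip B (Aᴴ * C) := by
  rw [rip, rip, Matrix.conjTranspose_mul, Matrix.mul_assoc]

theorem _root_.Matrix.PosSemidef.trace_re_nonneg {A : Matrix n n ℂ} (hA : A.PosSemidef) :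
    0 ≤ A.trace.re :=
  (Complex.le_def.1 hA.trace_nonneg).1

theorem rip_self_nonneg (A : Matrix m n ℂ) : 0 ≤ rip A A :=
  (Matrix.posSemidef_conjTranspose_mul_self A).trace_re_nonneg

theorem rip_self_eq_zero {A : Matrix m n ℂ} : rip A A = 0 ↔ A = 0 := by
  constructor
  · intro h
    apply Matrix.trace_conjTranspose_mul_self_eq_zero_iff.1
    have h2 := (Matrix.posSemidef_conjTranspose_mul_self A).trace_nonneg
    exact Complex.ext h (Complex.le_def.1 h2).2.symm
  · rintro rfl
    simp [rip]

theorem rip_one_one [DecidableEq n] : rip (1 : Matrix n n ℂ) 1 = Fintype.card n := by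
  simp [rip]

/-- The operator norm dominates multiplication from the left in the Frobenius norm. -/
theorem rip_mul_self_le [DecidableEq m] (A : Matrix p m ℂ) (B : Matrix m n ℂ) :
    rip (A * B) (A * B) ≤ ‖A‖ ^ 2 * rip B B := by
  have h := ((posSemidef_norm_sq_sub A).conjTranspose_mul_mul_same B).trace_re_nonneg
  rw [Matrix.mul_sub, Matrix.sub_mul, Matrix.trace_sub, Complex.sub_re] at h
  have h1 : (Bᴴ * (‖A‖ ^ 2 • (1 : Matrix m m ℂ)) * B).trace.re = ‖A‖ ^ 2 * rip B B := by
    rw [Matrix.mul_smul, Matrix.mul_one, Matrix.smul_mul, Matrix.trace_smul, Complex.smul_re,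
      smul_eq_mul, rip]
  have h2 : (Bᴴ * (Aᴴ * A) * B).trace.re = rip (A * B) (A * B) := by
    rw [rip, Matrix.conjTranspose_mul]
    simp only [Matrix.mul_assoc]
  linarith

theorem rip_mul_self_le' [DecidableEq m] [DecidableEq n] (A : Matrix p m ℂ) (B : Matrix m n ℂ) :
    rip (A * B) (A * B) ≤ rip A A * ‖B‖ ^ 2 := by
  have h := rip_mul_self_le Bᴴ Aᴴ
  rw [← Matrix.conjTranspose_mul, rip_conjTranspose, rip_conjTranspose,
    Matrix.l2_opNorm_conjTranspose] at h
  linarith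

theorem rip_self_le_card_mul [DecidableEq n] (A : Matrix m n ℂ) :
    rip A A ≤ Fintype.card n * ‖A‖ ^ 2 := by
  have h := rip_mul_self_le A (1 : Matrix n n ℂ)
  rw [Matrix.mul_one, rip_one_one] at h
  linarith

theorem rip_le (A B : Matrix m n ℂ) : |rip A B| ≤ √(rip A A) * √(rip B B) := by
  have h : ∀ t : ℝ, 0 ≤ rip B B * (t * t) + 2 * rip A B * t + rip A A := by
    intro t
    have h := rip_self_nonneg (A + t • B)
    rw [rip_add_left, rip_add_right, rip_add_right, rip_smul_left, rip_smul_left, rip_smul_right,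
      rip_smul_right, rip_comm B A] at h
    linarith
  have h2 := discrim_le_zero h
  rw [discrim] at h2
  rw [← Real.sqrt_mul (rip_self_nonneg A)]
  apply Real.le_sqrt_of_sq_le
  rw [sq_abs]
  linarith

theorem rip_self_eq_sum (A : Matrix m n ℂ) : rip A A = ∑ i, ∑ j, ‖A i j‖ ^ 2 := by
  rw [rip, Matrix.trace, Finset.sum_comm, Complex.re_sum]
  refine Finset.sum_congr rfl fun j _ => ?_
  rw [Matrix.diag_apply, Matrix.mul_apply, Complex.re_sum]
  refine Finset.sum_congr rfl fun i _ => ?_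
  rw [Matrix.conjTranspose_apply, Complex.star_def, ← Complex.normSq_eq_conj_mul_self,
    Complex.ofReal_re, Complex.normSq_eq_norm_sq]

/-- The operator norm is at most the Frobenius norm. -/
theorem norm_sq_le_rip [DecidableEq n] (A : Matrix m n ℂ) : ‖A‖ ^ 2 ≤ rip A A := by
  have h0 := rip_self_nonneg A
  rw [← Real.le_sqrt (norm_nonneg _) h0, Matrix.l2_opNorm_def]
  refine ContinuousLinearMap.opNorm_le_bound _ (Real.sqrt_nonneg _) fun x => ?_
  apply le_of_sq_le_sq _ (by positivity)
  rw [mul_pow, Real.sq_sqrt h0, EuclideanSpace.norm_sq_eq, EuclideanSpace.norm_sq_eq,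
    rip_self_eq_sum, Finset.sum_mul]
  refine Finset.sum_le_sum fun i _ => ?_
  have h1 : ‖∑ j, A i j * x j‖ ≤ ∑ j, ‖A i j‖ * ‖x j‖ :=
    (norm_sum_le _ _).trans_eq (by simp)
  calc _ = ‖∑ j, A i j * x j‖ ^ 2 := rfl
    _ ≤ (∑ j, ‖A i j‖ * ‖x j‖) ^ 2 := by gcongr
    _ ≤ _ := Finset.sum_mul_sq_le_sq_mul_sq _ _ _

end Norms

/-! ### Admissible weights and the Schulz iteration -/

section Schulz

variable {n : Type*} [Fintype n]

/-- `Adm ρ W E` says that `W` is positive definite and that the eigenvalues of `W E` are at most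
`ρ`. The latter is written as `W E W ≤ ρ W`, which avoids inverses and square roots. -/
structure Adm (ρ : ℝ) (W E : Matrix n n ℂ) : Prop where
  posDef : W.PosDef
  bound : (ρ • W - W * E * W).PosSemidef

theorem Adm.mono {ρ ρ' : ℝ} {W E : Matrix n n ℂ} (h : Adm ρ W E) (hρ : ρ ≤ ρ') :
    Adm ρ' W E := by
  refine ⟨h.posDef, ?_⟩
  have h1 : ρ' • W - W * E * W = (ρ' - ρ) • W + (ρ • W - W * E * W) := by
    rw [sub_smul]
    abel
  rw [h1]
  exact (h.posDef.posSemidef.smul (sub_nonneg.2 hρ)).add h.bound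

open scoped MatrixOrder in
/-- For `W = C Cᴴ`, admissibility is a bound on the Hermitian matrix `Cᴴ E C`, which is similar
to `E W`. -/
theorem Adm.exists_factor [DecidableEq n] {ρ : ℝ} {W E : Matrix n n ℂ} (h : Adm ρ W E) :
    ∃ C : Matrix n n ℂ, IsUnit C ∧ W = C * Cᴴ ∧
      (ρ • (1 : Matrix n n ℂ) - Cᴴ * E * C).PosSemidef := by
  obtain ⟨B, hB⟩ := CStarAlgebra.nonneg_iff_eq_star_mul_self.1 h.posDef.posSemidef.nonneg
  have hW : W = Bᴴ * (Bᴴ)ᴴ := by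
    rw [Matrix.conjTranspose_conjTranspose]
    exact hB
  have hC : IsUnit Bᴴ := by
    have hu := (Matrix.isUnit_iff_isUnit_det _).1 h.posDef.isUnit
    rw [hW, Matrix.det_mul] at hu
    exact (Matrix.isUnit_iff_isUnit_det _).2 (isUnit_of_mul_isUnit_left hu)
  refine ⟨Bᴴ, hC, hW, ?_⟩
  rw [← Matrix.IsUnit.posSemidef_star_right_conjugate_iff hC]
  convert h.bound using 1
  rw [Matrix.star_eq_conjTranspose, Matrix.mul_sub, Matrix.sub_mul, Matrix.mul_smul,
    Matrix.smul_mul, Matrix.mul_one, hW]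
  simp only [Matrix.mul_assoc]

theorem Adm.of_factor [DecidableEq n] {ρ : ℝ} {C E : Matrix n n ℂ} (hC : IsUnit C)
    (h : (ρ • (1 : Matrix n n ℂ) - Cᴴ * E * C).PosSemidef) : Adm ρ (C * Cᴴ) E := by
  refine ⟨?_, ?_⟩
  · have := (Matrix.PosDef.one (n := n) (R := ℂ))
    have h2 := (Matrix.IsUnit.posDef_star_right_conjugate_iff hC).2 this
    rwa [Matrix.mul_one] at h2
  · have h2 := h.mul_mul_conjTranspose_same C
    convert h2 using 1
    rw [Matrix.mul_sub, Matrix.sub_mul, Matrix.mul_smul, Matrix.smul_mul, Matrix.mul_one]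
    simp only [Matrix.mul_assoc]

/-- The Schulz iteration maps an eigenvalue `t` of `W E` to `t (2 - t) ≤ 1`, so that the
accumulated error is forgotten after one iteration. -/
theorem Adm.schulz [DecidableEq n] {ρ : ℝ} {W E : Matrix n n ℂ} (h : Adm ρ W E) (hE : E.IsHermitian)
    (hρ : ρ < 2) : Adm 1 (W * ((2 : ℝ) • (1 : Matrix n n ℂ) - E * W)) E := by
  have hW : Wᴴ = W := h.posDef.isHermitian
  have hE' : Eᴴ = E := hE
  have h1 : W * ((2 : ℝ) • (1 : Matrix n n ℂ) - E * W) = (2 - ρ) • W + (ρ • W - W * E * W) := by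
    rw [Matrix.mul_sub, Matrix.mul_smul, Matrix.mul_one, sub_smul, Matrix.mul_assoc]
    abel
  have hpd : (W * ((2 : ℝ) • (1 : Matrix n n ℂ) - E * W)).PosDef := by
    rw [h1]
    exact (h.posDef.smul (sub_pos.2 hρ)).add_posSemidef h.bound
  refine ⟨hpd, ?_⟩
  -- With `W'` the new weight, `W' - W' E W' = (1 - W E) W' (1 - W E)ᴴ`.
  have h2 := hpd.posSemidef.mul_mul_conjTranspose_same (1 - W * E)
  convert h2 using 1
  rw [Matrix.conjTranspose_sub, Matrix.conjTranspose_mul, Matrix.conjTranspose_one, hW, hE',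
    two_smul, one_smul]
  noncomm_ring

/-- `t - t² - log (2 - t) ≤ 0` up to the zero `δ` of the left hand side: the change of
`t - log t` under `t ↦ t (2 - t)`. The left hand side increases on `[0, 1]`, decreases on
`[1, 3/2]` and increases on `[3/2, 2)`. -/
theorem sub_sq_sub_log_nonpos {δ t : ℝ} (hδ1 : 1 < δ) (hδ2 : δ < 2)
    (hδ : δ - δ ^ 2 - Real.log (2 - δ) = 0) (ht0 : 0 ≤ t) (ht : t ≤ δ) :
    t - t ^ 2 - Real.log (2 - t) ≤ 0 := by
  set g : ℝ → ℝ := fun t => t - t ^ 2 - Real.log (2 - t) with hg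
  have hd : ∀ x, x < 2 → HasDerivAt g ((2 * x - 3) * (x - 1) / (2 - x)) x := by
    intro x hx
    have h2 : (2 - x) ≠ 0 := by linarith
    have h := ((hasDerivAt_id x).sub ((hasDerivAt_id x).pow 2)).sub
      (((hasDerivAt_const x (2 : ℝ)).sub (hasDerivAt_id x)).log h2)
    refine HasDerivAt.congr_deriv (f := g) h ?_
    simp only [Pi.sub_apply, id, Nat.cast_ofNat]
    field_simp
    ring
  have hc : ∀ s : Set ℝ, (∀ x ∈ s, x < 2) → ContinuousOn g s := fun s hs x hx =>
    (hd x (hs x hx)).continuousAt.continuousWithinAt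
  have h1 : g 1 = 0 := by norm_num [hg]
  have hδ' : g δ = 0 := hδ
  change g t ≤ 0
  rcases le_total t 1 with h | h
  · have hm : MonotoneOn g (Set.Icc 0 1) := by
      refine monotoneOn_of_deriv_nonneg (convex_Icc _ _)
        (hc _ fun x hx => by linarith [hx.2]) ?_ ?_
      · intro x hx
        rw [interior_Icc] at hx
        exact (hd x (by linarith [hx.2])).differentiableAt.differentiableWithinAt
      · intro x hx
        rw [interior_Icc] at hx
        rw [(hd x (by linarith [hx.2])).deriv]
        exact div_nonneg (by nlinarith [hx.2]) (by linarith [hx.2])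
    rw [← h1]
    exact hm ⟨ht0, h⟩ ⟨zero_le_one, le_rfl⟩ h
  rcases le_total t (3 / 2) with h' | h'
  · have hm : AntitoneOn g (Set.Icc 1 (3 / 2)) := by
      refine antitoneOn_of_deriv_nonpos (convex_Icc _ _)
        (hc _ fun x hx => by linarith [hx.2]) ?_ ?_
      · intro x hx
        rw [interior_Icc] at hx
        exact (hd x (by linarith [hx.2])).differentiableAt.differentiableWithinAt
      · intro x hx
        rw [interior_Icc] at hx
        rw [(hd x (by linarith [hx.2])).deriv]
        exact div_nonpos_of_nonpos_of_nonneg (by nlinarith [hx.1, hx.2]) (by linarith [hx.2])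
    rw [← h1]
    exact hm ⟨le_rfl, by norm_num⟩ ⟨h, h'⟩ h
  · have hm : MonotoneOn g (Set.Icc (3 / 2) δ) := by
      refine monotoneOn_of_deriv_nonneg (convex_Icc _ _)
        (hc _ fun x hx => by linarith [hx.2]) ?_ ?_
      · intro x hx
        rw [interior_Icc] at hx
        exact (hd x (by linarith [hx.2])).differentiableAt.differentiableWithinAt
      · intro x hx
        rw [interior_Icc] at hx
        rw [(hd x (by linarith [hx.2])).deriv]
        exact div_nonneg (by nlinarith [hx.1]) (by linarith [hx.2])
    rw [← hδ']
    exact hm ⟨h', ht⟩ ⟨h'.trans ht, le_rfl⟩ ht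

theorem det_two_sub [DecidableEq n] {A : Matrix n n ℂ} (hA : A.IsHermitian) :
    ((2 : ℝ) • (1 : Matrix n n ℂ) - A).det = ((∏ i, (2 - hA.eigenvalues i) : ℝ) : ℂ) := by
  have h := congrArg (Polynomial.eval 2) hA.charpoly_eq
  rw [Matrix.eval_charpoly, Polynomial.eval_prod] at h
  have h2 : Matrix.scalar n (2 : ℂ) = (2 : ℝ) • (1 : Matrix n n ℂ) := by
    rw [Matrix.scalar_apply, ← Matrix.smul_one_eq_diagonal]
    ext i j
    simp
  rw [← h2, h]
  simp

theorem trace_eq_sum [DecidableEq n] {A : Matrix n n ℂ} (hA : A.IsHermitian) :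
    A.trace.re = ∑ i, hA.eigenvalues i := by
  rw [hA.trace_eq_sum_eigenvalues]
  simp

theorem trace_mul_self_eq_sum [DecidableEq n] {A : Matrix n n ℂ} (hA : A.IsHermitian) :
    (A * A).trace.re = ∑ i, hA.eigenvalues i ^ 2 := by
  set U := (hA.eigenvectorUnitary : Matrix n n ℂ) with hU
  set D : Matrix n n ℂ := Matrix.diagonal (RCLike.ofReal ∘ hA.eigenvalues) with hD
  have hs : A = U * D * star U := by
    have := hA.spectral_theorem
    rwa [Unitary.conjStarAlgAut_apply] at this
  have hUU : star U * U = 1 := Unitary.coe_star_mul_self _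
  have h1 : A * A = U * (D * D) * star U := by
    calc A * A = (U * D * star U) * (U * D * star U) := by rw [← hs]
      _ = U * D * (star U * U) * D * star U := by simp only [Matrix.mul_assoc]
      _ = _ := by rw [hUU, Matrix.mul_one]; simp only [Matrix.mul_assoc]
  rw [h1, Matrix.trace_mul_comm, ← Matrix.mul_assoc, hUU, Matrix.one_mul, hD,
    Matrix.diagonal_mul_diagonal, Matrix.trace_diagonal, Complex.re_sum]
  refine Finset.sum_congr rfl fun i _ => ?_
  simp [sq]

open scoped MatrixOrder in
/-- One Schulz iteration does not increase `Tr (W E) - log det W`. -/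
theorem Adm.schulz_cost_le [DecidableEq n] {ρ δ : ℝ} {W E : Matrix n n ℂ} (h : Adm ρ W E)
    (hE : E.PosSemidef) (hδ1 : 1 < δ)
    (hδ2 : δ < 2) (hδ : δ - δ ^ 2 - Real.log (2 - δ) = 0) (hρ : ρ ≤ δ) :
    (W * ((2 : ℝ) • (1 : Matrix n n ℂ) - E * W) * E).trace.re
        - Real.log (W * ((2 : ℝ) • (1 : Matrix n n ℂ) - E * W)).det.re
      ≤ (W * E).trace.re - Real.log W.det.re := by
  have hWpd := h.posDef
  obtain ⟨C, hC, hW, hb⟩ := (h.mono hρ).exists_factor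
  set A := Cᴴ * E * C with hA
  have hApsd : A.PosSemidef := hE.conjTranspose_mul_mul_same C
  set l := hApsd.1.eigenvalues with hl
  have hl0 : ∀ i, 0 ≤ l i := hApsd.eigenvalues_nonneg
  have hlδ : ∀ i, l i ≤ δ := by
    intro i
    have h1 : A ≤ algebraMap ℝ (Matrix n n ℂ) δ := by
      rw [Matrix.le_iff, Algebra.algebraMap_eq_smul_one]
      exact hb
    exact (le_algebraMap_iff_spectrum_le (ha := hApsd.1)).1 h1 _
      (hApsd.1.eigenvalues_mem_spectrum_real i)
  have htr : (W * E).trace.re = ∑ i, l i := by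
    rw [← trace_eq_sum, hW, Matrix.mul_assoc, Matrix.trace_mul_comm]
  have htr2 : (W * ((2 : ℝ) • (1 : Matrix n n ℂ) - E * W) * E).trace.re
      = ∑ i, (2 * l i - l i ^ 2) := by
    have h1 : W * ((2 : ℝ) • (1 : Matrix n n ℂ) - E * W) * E
        = (2 : ℝ) • (W * E) - C * (Cᴴ * E * C * Cᴴ * E) := by
      rw [Matrix.mul_sub, Matrix.sub_mul, Matrix.mul_smul, Matrix.smul_mul, Matrix.mul_one, hW]
      simp only [Matrix.mul_assoc]
    rw [h1, Matrix.trace_sub, Matrix.trace_smul, Complex.sub_re, Complex.smul_re, htr,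
      Matrix.trace_mul_comm, Finset.sum_sub_distrib, ← Finset.mul_sum, ← trace_mul_self_eq_sum,
      smul_eq_mul, hA]
    simp only [Matrix.mul_assoc]
  have hdet : (W * ((2 : ℝ) • (1 : Matrix n n ℂ) - E * W)).det.re
      = W.det.re * ∏ i, (2 - l i) := by
    have h1 : W * ((2 : ℝ) • (1 : Matrix n n ℂ) - E * W)
        = C * ((2 : ℝ) • (1 : Matrix n n ℂ) - A) * Cᴴ := by
      rw [Matrix.mul_sub, Matrix.mul_sub, Matrix.sub_mul, Matrix.mul_smul, Matrix.mul_smul,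
        Matrix.smul_mul, Matrix.mul_one, Matrix.mul_one, hW, hA]
      simp only [Matrix.mul_assoc]
    rw [h1, Matrix.det_mul, Matrix.det_mul, mul_right_comm, ← Matrix.det_mul, ← hW,
      det_two_sub hApsd.1, Complex.re_mul_ofReal]
  have hpos : ∀ i, 0 < 2 - l i := fun i => by linarith [hlδ i]
  have hWdet : 0 < W.det.re := (Complex.lt_def.1 hWpd.det_pos).1
  rw [htr2, hdet, htr, Real.log_mul hWdet.ne' (Finset.prod_pos fun i _ => hpos i).ne',
    Real.log_prod (fun i _ => (hpos i).ne')]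
  have hsum : ∑ i, (l i - l i ^ 2 - Real.log (2 - l i)) ≤ 0 :=
    Finset.sum_nonpos fun i _ => sub_sq_sub_log_nonpos hδ1 hδ2 hδ (hl0 i) (hlδ i)
  simp only [Finset.sum_sub_distrib, ← Finset.mul_sum] at hsum ⊢
  linarith

end Schulz

/-! ### Perturbations of admissible weights -/

section Steps

variable {m n p : Type*} [Fintype m] [Fintype n] [Fintype p]

theorem norm_one_le [DecidableEq n] : ‖(1 : Matrix n n ℂ)‖ ≤ 1 := by
  have h : ‖(1 : Matrix n n ℂ)‖ ^ 2 ≤ 1 :=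
    norm_sq_le_of_posSemidef zero_le_one (by simpa using Matrix.PosSemidef.zero)
  nlinarith [norm_nonneg (1 : Matrix n n ℂ)]

/-- A perturbation of `E` of size `θ`, measured in the coordinates in which `W` is the identity,
moves the admissible bound by at most `θ`. -/
theorem Adm.of_norm_sub_le [DecidableEq n] {ρ θ : ℝ} {C E E' : Matrix n n ℂ} (hC : IsUnit C)
    (h : (ρ • (1 : Matrix n n ℂ) - Cᴴ * E * C).PosSemidef) (hE : E.IsHermitian)
    (hE' : E'.IsHermitian) (hθ : ‖Cᴴ * (E' - E) * C‖ ≤ θ) : Adm (ρ + θ) (C * Cᴴ) E' := by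
  apply Adm.of_factor hC
  have h1 := posSemidef_smul_one_sub
    (Matrix.isHermitian_conjTranspose_mul_mul C (hE'.sub hE)) hθ
  convert h.add h1 using 1
  rw [add_smul, Matrix.mul_sub, Matrix.sub_mul]
  abel

theorem rip_mul_le [DecidableEq n] {Q : Matrix n n ℂ} (hQ : Q.IsHermitian) {q : ℝ} (hq : ‖Q‖ ≤ q)
    (X : Matrix n m ℂ) : rip X (Q * X) ≤ q * rip X X := by
  have h := ((posSemidef_smul_one_sub hQ hq).conjTranspose_mul_mul_same X).trace_re_nonneg
  rw [Matrix.mul_sub, Matrix.sub_mul, Matrix.mul_smul, Matrix.mul_one, Matrix.smul_mul,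
    Matrix.trace_sub, Matrix.trace_smul, Complex.sub_re, Complex.smul_re, smul_eq_mul,
    Matrix.mul_assoc] at h
  simp only [rip]
  linarith

theorem trace_mul_conjTranspose_self_mul (C M : Matrix n n ℂ) :
    (C * Cᴴ * M).trace = (Cᴴ * M * C).trace := by
  rw [Matrix.mul_assoc, Matrix.trace_mul_comm]

end Steps

variable {K M N d : ℕ}

/-! ### The cost and the MSE matrices -/

/-- The standing assumptions on the channels, the priorities and the constant `δ`. -/
structure Params (c : Downlink K M N d) (κ a δ : ℝ) : Prop where
  P_pos : 0 < c.P
  σ_pos : 0 < c.σ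
  norm_H : ∀ k, ‖c.H k‖ ^ 2 ≤ κ
  α_nonneg : ∀ k, 0 ≤ c.α k
  α_le : ∀ k, c.α k ≤ a
  one_lt_δ : 1 < δ
  δ_lt_two : δ < 2
  δ_eq : δ - δ ^ 2 - Real.log (2 - δ) = 0

theorem power_eq (V : Fin K → Matrix (Fin M) (Fin d) ℂ) : power V = ∑ m, rip (V m) (V m) := by
  simp only [power, rip]
  exact Finset.sum_congr rfl fun m _ => by rw [Matrix.trace_mul_comm]

theorem power_nonneg (V : Fin K → Matrix (Fin M) (Fin d) ℂ) : 0 ≤ power V := by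
  rw [power_eq]
  exact Finset.sum_nonneg fun m _ => rip_self_nonneg _

theorem norm_sq_le_power (V : Fin K → Matrix (Fin M) (Fin d) ℂ) (k : Fin K) :
    ‖V k‖ ^ 2 ≤ power V := by
  rw [power_eq]
  exact (norm_sq_le_rip _).trans
    (Finset.single_le_sum (f := fun m => rip (V m) (V m)) (fun m _ => rip_self_nonneg _)
      (Finset.mem_univ k))

theorem power_eq_zero {V : Fin K → Matrix (Fin M) (Fin d) ℂ} : power V = 0 ↔ V = 0 := by
  rw [power_eq, Finset.sum_eq_zero_iff_of_nonneg fun m _ => rip_self_nonneg _]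
  simp [rip_self_eq_zero, funext_iff]

theorem power_smul (r : ℝ) (V : Fin K → Matrix (Fin M) (Fin d) ℂ) :
    power (fun k => r • V k) = r ^ 2 * power V := by
  simp only [power_eq, rip_smul_left, rip_smul_right, Finset.mul_sum]
  exact Finset.sum_congr rfl fun m _ => by ring

/-- The covariance matrix `∑ₘ Hₖ Vₘ Vₘᴴ Hₖᴴ + (power V / P) σ² I` of the signal received by
user `k`. -/
def cov (c : Downlink K M N d) (V : Fin K → Matrix (Fin M) (Fin d) ℂ) (k : Fin K) :
    Matrix (Fin N) (Fin N) ℂ :=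
  (∑ m, c.H k * V m * (V m)ᴴ) * (c.H k)ᴴ
    + (power V / c.P * c.σ ^ 2) • (1 : Matrix (Fin N) (Fin N) ℂ)

theorem isHermitian_cov (c : Downlink K M N d) (V : Fin K → Matrix (Fin M) (Fin d) ℂ)
    (k : Fin K) : (cov c V k).IsHermitian := by
  rw [Matrix.IsHermitian, cov, Matrix.conjTranspose_add, Matrix.conjTranspose_smul]
  congr 1
  · simp only [Matrix.sum_mul, Matrix.conjTranspose_sum, Matrix.conjTranspose_mul,
      Matrix.conjTranspose_conjTranspose, Matrix.mul_assoc]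
  · simp

/-- `E k` as a quadratic function of the receiver `U k`. -/
theorem E_eq (c : Downlink K M N d) (U : Fin K → Matrix (Fin N) (Fin d) ℂ)
    (V : Fin K → Matrix (Fin M) (Fin d) ℂ) (k : Fin K) :
    E c U V k = 1 - (U k)ᴴ * (c.H k * V k) - (c.H k * V k)ᴴ * U k
      + (U k)ᴴ * cov c V k * U k := by
  have h : (U k)ᴴ * ((∑ m, c.H k * V m * (V m)ᴴ) * (c.H k)ᴴ) * U k
      = ((U k)ᴴ * c.H k * V k) * ((U k)ᴴ * c.H k * V k)ᴴ
        + ∑ m ∈ Finset.univ.erase k, (U k)ᴴ * c.H k * V m * (V m)ᴴ * (c.H k)ᴴ * U k := by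
    rw [← Finset.add_sum_erase _ _ (Finset.mem_univ k)]
    simp only [Matrix.add_mul, Matrix.mul_add, Matrix.sum_mul, Matrix.mul_sum,
      Matrix.conjTranspose_mul, Matrix.conjTranspose_conjTranspose, Matrix.mul_assoc]
  rw [E, cov, Matrix.mul_add, Matrix.add_mul, h]
  simp only [Matrix.sub_mul, Matrix.mul_sub, Matrix.conjTranspose_sub, Matrix.conjTranspose_one,
    Matrix.one_mul, Matrix.mul_one, Matrix.conjTranspose_mul, Matrix.conjTranspose_conjTranspose,
    Matrix.mul_smul, Matrix.smul_mul, Matrix.mul_assoc]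
  abel

theorem posSemidef_interference (c : Downlink K M N d) (U : Fin K → Matrix (Fin N) (Fin d) ℂ)
    (V : Fin K → Matrix (Fin M) (Fin d) ℂ) (k : Fin K) :
    (∑ m ∈ Finset.univ.erase k,
      (U k)ᴴ * c.H k * V m * (V m)ᴴ * (c.H k)ᴴ * U k).PosSemidef := by
  refine Matrix.posSemidef_sum _ fun m _ => ?_
  have h := Matrix.posSemidef_self_mul_conjTranspose ((U k)ᴴ * c.H k * V m)
  simpa only [Matrix.conjTranspose_mul, Matrix.conjTranspose_conjTranspose, Matrix.mul_assoc]
    using h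

theorem posSemidef_E {c : Downlink K M N d} (hP : 0 < c.P) (U : Fin K → Matrix (Fin N) (Fin d) ℂ)
    (V : Fin K → Matrix (Fin M) (Fin d) ℂ) (k : Fin K) : (E c U V k).PosSemidef := by
  refine ((Matrix.posSemidef_self_mul_conjTranspose _).add (posSemidef_interference c U V k)).add
    ((Matrix.posSemidef_conjTranspose_mul_self _).smul ?_)
  have := power_nonneg V
  positivity

variable {c : Downlink K M N d} {κ a δ : ℝ}

theorem Params.κ_nonneg (hp : Params c κ a δ) (k : Fin K) : 0 ≤ κ :=
  (sq_nonneg _).trans (hp.norm_H k)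

theorem Params.a_nonneg (hp : Params c κ a δ) (k : Fin K) : 0 ≤ a :=
  (hp.α_nonneg k).trans (hp.α_le k)

theorem Params.norm_H_le (hp : Params c κ a δ) (k : Fin K) : ‖c.H k‖ ≤ √κ :=
  Real.le_sqrt_of_sq_le (hp.norm_H k)

theorem Params.δ_pos (hp : Params c κ a δ) : 0 < δ := zero_lt_one.trans hp.one_lt_δ

theorem norm_V_le {V : Fin K → Matrix (Fin M) (Fin d) ℂ} (hV : power V = c.P) (k : Fin K) :
    ‖V k‖ ≤ √c.P :=
  Real.le_sqrt_of_sq_le (hV ▸ norm_sq_le_power V k)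

theorem Params.norm_HV_le (hp : Params c κ a δ) {V : Fin K → Matrix (Fin M) (Fin d) ℂ}
    (hV : power V = c.P) (k : Fin K) : ‖c.H k * V k‖ ≤ √(c.P * κ) := by
  rw [Real.sqrt_mul hp.P_pos.le, mul_comm √c.P]
  exact (Matrix.l2_opNorm_mul _ _).trans
    (mul_le_mul (hp.norm_H_le k) (norm_V_le hV k) (norm_nonneg _) (Real.sqrt_nonneg _))

theorem Params.norm_cov_le (hp : Params c κ a δ) {V : Fin K → Matrix (Fin M) (Fin d) ℂ}
    (hV : power V = c.P) (k : Fin K) : ‖cov c V k‖ ≤ c.P * κ + c.σ ^ 2 := by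
  have hκ := hp.κ_nonneg k
  rw [cov, hV, div_self hp.P_pos.ne', one_mul, Matrix.sum_mul]
  refine (norm_add_le _ _).trans (add_le_add ?_ ?_)
  · calc ‖∑ m, c.H k * V m * (V m)ᴴ * (c.H k)ᴴ‖
        ≤ ∑ m, κ * rip (V m) (V m) := norm_sum_le_of_le _ fun m _ => ?_
      _ = c.P * κ := by rw [← Finset.mul_sum, ← power_eq, hV, mul_comm]
    have h1 : c.H k * V m * (V m)ᴴ * (c.H k)ᴴ = (c.H k * V m) * (c.H k * V m)ᴴ := by
      rw [Matrix.conjTranspose_mul]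
      simp only [Matrix.mul_assoc]
    rw [h1, norm_self_mul_conjTranspose]
    calc ‖c.H k * V m‖ ^ 2 ≤ (‖c.H k‖ * ‖V m‖) ^ 2 := by
          gcongr
          exact Matrix.l2_opNorm_mul _ _
      _ = ‖c.H k‖ ^ 2 * ‖V m‖ ^ 2 := mul_pow _ _ _
      _ ≤ κ * rip (V m) (V m) :=
          mul_le_mul (hp.norm_H k) (norm_sq_le_rip _) (sq_nonneg _) hκ
  · rw [norm_real_smul, abs_of_nonneg (sq_nonneg _)]
    exact mul_le_of_le_one_right (sq_nonneg _) norm_one_le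

/-- The noise term of `E` bounds the receiver `U k`, and `E` is bounded below by
`σ² / (P κ + σ²)`, both in the coordinates in which the weight is the identity. For the second,
`C = Y X` with `X` the column of the blocks `(I - Vₖᴴ Hₖᴴ Uₖ) C` and `σ Uₖ C`, and `Y` the row of
`I` and `σ⁻¹ Vₖᴴ Hₖᴴ`. -/
theorem Params.factor_bounds (hp : Params c κ a δ) {U : Fin K → Matrix (Fin N) (Fin d) ℂ}
    {V : Fin K → Matrix (Fin M) (Fin d) ℂ} (hV : power V = c.P) {k : Fin K}
    {C : Matrix (Fin d) (Fin d) ℂ}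
    (h : (δ • (1 : Matrix (Fin d) (Fin d) ℂ) - Cᴴ * E c U V k * C).PosSemidef) :
    ‖U k * C‖ ≤ √δ / c.σ ∧ ‖C‖ ≤ √δ * √(c.P * κ + c.σ ^ 2) / c.σ := by
  have hσ := hp.σ_pos
  have hδ := hp.δ_pos
  have hκ := hp.κ_nonneg k
  have hPκ : 0 ≤ c.P * κ := mul_nonneg hp.P_pos.le hκ
  set A := (1 - (U k)ᴴ * c.H k * V k)ᴴ * C with hA
  set B := c.σ • (U k * C) with hB
  have hsplit : Cᴴ * E c U V k * C = Aᴴ * A + Cᴴ * (∑ m ∈ Finset.univ.erase k,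
      (U k)ᴴ * c.H k * V m * (V m)ᴴ * (c.H k)ᴴ * U k) * C + Bᴴ * B := by
    rw [E, hV, div_self hp.P_pos.ne', one_mul, hA, hB, Matrix.conjTranspose_smul,
      Matrix.smul_mul, Matrix.mul_smul, smul_smul, star_trivial, ← sq]
    simp only [Matrix.mul_add, Matrix.add_mul, Matrix.conjTranspose_mul,
      Matrix.conjTranspose_conjTranspose, Matrix.mul_smul, Matrix.smul_mul, Matrix.mul_assoc]
  have hI := (posSemidef_interference c U V k).conjTranspose_mul_mul_same C
  have hX : (δ • (1 : Matrix (Fin d) (Fin d) ℂ) - (Aᴴ * A + Bᴴ * B)).PosSemidef := by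
    convert h.add hI using 1
    rw [hsplit]
    abel
  constructor
  · have h1 : ‖B‖ ^ 2 ≤ δ := by
      refine norm_sq_le_of_posSemidef hδ.le ?_
      convert hX.add (Matrix.posSemidef_conjTranspose_mul_self A) using 1
      abel
    rw [hB, norm_real_smul, abs_of_pos hσ] at h1
    rw [le_div_iff₀ hσ, mul_comm]
    exact Real.le_sqrt_of_sq_le h1
  · have hXn : ‖Matrix.fromRows A B‖ ^ 2 ≤ δ := by
      refine norm_sq_le_of_posSemidef hδ.le ?_
      rwa [Matrix.conjTranspose_fromRows_eq_fromCols_conjTranspose, Matrix.fromCols_mul_fromRows]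
    set Y := Matrix.fromCols (1 : Matrix (Fin d) (Fin d) ℂ) (c.σ⁻¹ • (c.H k * V k)ᴴ) with hY
    have hYn : ‖Y‖ ^ 2 ≤ 1 + (c.P * κ) / c.σ ^ 2 := by
      rw [← norm_self_mul_conjTranspose, hY,
        Matrix.conjTranspose_fromCols_eq_fromRows_conjTranspose,
        Matrix.fromCols_mul_fromRows]
      refine (norm_add_le _ _).trans (add_le_add ?_ ?_)
      · rw [Matrix.conjTranspose_one, Matrix.one_mul]
        exact norm_one_le
      · rw [norm_self_mul_conjTranspose, norm_real_smul, Matrix.l2_opNorm_conjTranspose, mul_pow,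
          sq_abs, inv_pow, div_eq_inv_mul]
        gcongr
        exact (Real.le_sqrt (norm_nonneg _) hPκ).1 (hp.norm_HV_le hV k)
    have hYX : Y * Matrix.fromRows A B = C := by
      rw [hY, Matrix.fromCols_mul_fromRows, hA, hB, Matrix.smul_mul, Matrix.mul_smul, smul_smul,
        inv_mul_cancel₀ hσ.ne', one_smul, Matrix.one_mul, Matrix.conjTranspose_sub,
        Matrix.conjTranspose_one, Matrix.sub_mul, Matrix.one_mul]
      simp only [Matrix.conjTranspose_mul, Matrix.conjTranspose_conjTranspose, Matrix.mul_assoc]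
      abel
    apply le_of_sq_le_sq _ (by positivity)
    rw [div_pow, mul_pow, Real.sq_sqrt hδ.le, Real.sq_sqrt (by positivity)]
    calc ‖C‖ ^ 2 = ‖Y * Matrix.fromRows A B‖ ^ 2 := by rw [hYX]
      _ ≤ (‖Y‖ * ‖Matrix.fromRows A B‖) ^ 2 := by
          gcongr
          exact Matrix.l2_opNorm_mul _ _
      _ = ‖Y‖ ^ 2 * ‖Matrix.fromRows A B‖ ^ 2 := mul_pow _ _ _
      _ ≤ (1 + (c.P * κ) / c.σ ^ 2) * δ := by gcongr
      _ = _ := by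
          field_simp
          ring

/-! ### The step on the receivers -/

theorem gradU_eq (c : Downlink K M N d) (x : Vars K M N d) (k : Fin K) :
    gradU c x k = (2 * c.α k) • ((cov c x.V k * x.U k - c.H k * x.V k) * x.W k) := by
  have h : 2 * c.α k * c.σ ^ 2 / c.P * power x.V
      = (2 * c.α k) * (power x.V / c.P * c.σ ^ 2) := by ring
  rw [gradU, cov, h, mul_smul (2 * c.α k) (power x.V / c.P * c.σ ^ 2), ← smul_add]
  congr 1
  simp only [Matrix.add_mul, Matrix.sub_mul, Matrix.neg_mul, Matrix.smul_mul, Matrix.one_mul]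
  abel

theorem E_sub_of_receiver (c : Downlink K M N d) {U U' : Fin K → Matrix (Fin N) (Fin d) ℂ}
    (V : Fin K → Matrix (Fin M) (Fin d) ℂ) (k : Fin K) {D : Matrix (Fin N) (Fin d) ℂ}
    (hD : U' k = U k + D) :
    E c U' V k - E c U V k = Dᴴ * (cov c V k * U k - c.H k * V k)
      + (cov c V k * U k - c.H k * V k)ᴴ * D + Dᴴ * cov c V k * D := by
  have hQ : (cov c V k)ᴴ = cov c V k := isHermitian_cov c V k
  rw [E_eq, E_eq, hD]
  simp only [Matrix.conjTranspose_add, Matrix.conjTranspose_sub, Matrix.conjTranspose_mul, hQ,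
    Matrix.add_mul, Matrix.mul_add, Matrix.sub_mul, Matrix.mul_sub, Matrix.mul_assoc]
  abel

theorem sqrt_consts (hp : Params c κ a δ) (k : Fin K) :
    √δ ^ 2 = δ ∧ √(c.P * κ + c.σ ^ 2) ^ 2 = c.P * κ + c.σ ^ 2 ∧ √(c.P * κ) ^ 2 = c.P * κ ∧
      √(c.P * κ * (c.P * κ + c.σ ^ 2)) = √(c.P * κ) * √(c.P * κ + c.σ ^ 2) := by
  have hPκ : 0 ≤ c.P * κ := mul_nonneg hp.P_pos.le (hp.κ_nonneg k)
  exact ⟨Real.sq_sqrt hp.δ_pos.le, Real.sq_sqrt (by positivity), Real.sq_sqrt hPκ,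
    Real.sqrt_mul hPκ _⟩

/-- The gradient with respect to `U k` is `2 αₖ R Wₖ` with the residual `R = cov Uₖ - Hₖ Vₖ`.
Bounding the two terms of `R` separately gives the factor that enters `μu` and `Ld`. -/
theorem Params.norm_residual_le (hp : Params c κ a δ) {U : Fin K → Matrix (Fin N) (Fin d) ℂ}
    {V : Fin K → Matrix (Fin M) (Fin d) ℂ} (hV : power V = c.P) {k : Fin K}
    {C : Matrix (Fin d) (Fin d) ℂ}
    (h : (δ • (1 : Matrix (Fin d) (Fin d) ℂ) - Cᴴ * E c U V k * C).PosSemidef) :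
    ‖(cov c V k * U k - c.H k * V k) * C‖ ≤
      √δ * √(c.P * κ + c.σ ^ 2) * (√(c.P * κ) + √(c.P * κ + c.σ ^ 2)) / c.σ := by
  obtain ⟨hU, hC⟩ := hp.factor_bounds hV h
  have hσ := hp.σ_pos
  have hq : 0 ≤ c.P * κ + c.σ ^ 2 :=
    add_nonneg (mul_nonneg hp.P_pos.le (hp.κ_nonneg k)) (sq_nonneg _)
  rw [Matrix.sub_mul, Matrix.mul_assoc]
  calc _ ≤ ‖cov c V k‖ * ‖U k * C‖ + ‖c.H k * V k‖ * ‖C‖ :=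
        (norm_sub_le _ _).trans (add_le_add (Matrix.l2_opNorm_mul _ _) (Matrix.l2_opNorm_mul _ _))
    _ ≤ (c.P * κ + c.σ ^ 2) * (√δ / c.σ)
        + √(c.P * κ) * (√δ * √(c.P * κ + c.σ ^ 2) / c.σ) := by
        gcongr
        · exact hp.norm_cov_le hV k
        · exact hp.norm_HV_le hV k
    _ = _ := by
        have h2 := Real.sq_sqrt hq
        field_simp
        linear_combination (-√δ) * h2

/-- One gradient step on `U` for user `k`: the eigenvalues of `W k E k` grow by at most `θ`, and the
part of the cost that depends on `U k` does not increase. The constants come from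
`Params.norm_residual_le` and `Params.factor_bounds`: in the coordinates in which the weight is the
identity, the linear part of the change of `E k` has norm at most `Ld γ` and the quadratic part at
most `Lc γ²`. -/
theorem Params.stepU_user (hp : Params c κ a δ) {x : Vars K M N d} (hV : power x.V = c.P)
    {γ θ ρ : ℝ} (hγ : 0 ≤ γ) (hL : γ * Lu c.P κ c.σ a δ ≤ 1)
    (hθ : Lc c.P κ c.σ a δ * γ ^ 2 + Ld c.P κ c.σ a δ * γ ≤ θ) {k : Fin K} (hρ : ρ ≤ δ)
    (h : Adm ρ (x.W k) (E c x.U x.V k)) :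
    Adm (ρ + θ) (x.W k) (E c (stepU c γ x).U x.V k) ∧
      c.α k * (x.W k * E c (stepU c γ x).U x.V k).trace.re
        ≤ c.α k * (x.W k * E c x.U x.V k).trace.re := by
  have hσ := hp.σ_pos
  have hα := hp.α_nonneg k
  have hαa := hp.α_le k
  have ha0 := hp.a_nonneg k
  have hδ := hp.δ_pos
  obtain ⟨e1, e2, e3, e4⟩ := sqrt_consts hp k
  obtain ⟨C, hC, hW, hb⟩ := h.exists_factor
  have hb' : (δ • (1 : Matrix (Fin d) (Fin d) ℂ) - Cᴴ * E c x.U x.V k * C).PosSemidef := by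
    convert hb.add (Matrix.PosSemidef.one.smul (sub_nonneg.2 hρ)) using 1
    rw [sub_smul]
    abel
  have hR := hp.norm_residual_le hV hb'
  have hCn := (hp.factor_bounds hV hb').2
  have hQ := hp.norm_cov_le hV k
  set Q := cov c x.V k with hQdef
  set R := Q * x.U k - c.H k * x.V k with hRdef
  set G := gradU c x k with hGdef
  have hG : G = (2 * c.α k) • (R * x.W k) := gradU_eq c x k
  have hU' : (stepU c γ x).U k = x.U k + (-γ) • G := by
    rw [neg_smul, ← sub_eq_add_neg]
    rfl
  have hdiff := E_sub_of_receiver c x.V k hU'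
  rw [← hQdef, ← hRdef] at hdiff
  set s := √δ with hs
  set q := √(c.P * κ + c.σ ^ 2) with hq
  set p := √(c.P * κ) with hpp
  have hs0 : 0 ≤ s := Real.sqrt_nonneg _
  have hq0 : 0 ≤ q := Real.sqrt_nonneg _
  have hp0 : 0 ≤ p := Real.sqrt_nonneg _
  have hGn : ‖G‖ ≤ μu c.P κ c.σ a δ := by
    have hR2 : R * x.W k = R * C * Cᴴ := by rw [hW, Matrix.mul_assoc]
    rw [hG, norm_real_smul, abs_of_nonneg (by positivity), hR2]
    calc 2 * c.α k * ‖R * C * Cᴴ‖ ≤ 2 * a * ((s * q * (p + q) / c.σ) * (s * q / c.σ)) := by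
          gcongr
          refine (Matrix.l2_opNorm_mul (R * C) Cᴴ).trans ?_
          rw [Matrix.l2_opNorm_conjTranspose]
          gcongr
      _ = _ := by
          rw [μu, e4, ← e1, ← hq]
          field_simp
          linear_combination (s ^ 2 * q * a) * e2
  set g := μu c.P κ c.σ a δ with hg
  have hg0 : 0 ≤ g := (norm_nonneg _).trans hGn
  constructor
  · have key : ‖Cᴴ * (E c (stepU c γ x).U x.V k - E c x.U x.V k) * C‖ ≤ θ := by
      have h1 : Cᴴ * (E c (stepU c γ x).U x.V k - E c x.U x.V k) * C
          = (-γ) • ((G * C)ᴴ * (R * C) + (R * C)ᴴ * (G * C))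
            + γ ^ 2 • ((G * C)ᴴ * Q * (G * C)) := by
        rw [hdiff, Matrix.conjTranspose_smul, star_trivial]
        simp only [Matrix.mul_add, Matrix.add_mul, Matrix.smul_mul, Matrix.mul_smul, smul_smul,
          Matrix.conjTranspose_mul, Matrix.mul_assoc, smul_add, ← sq, neg_sq]
      have hGC : ‖G * C‖ ≤ g * (s * q / c.σ) :=
        (Matrix.l2_opNorm_mul _ _).trans (by gcongr)
      have hRG : ‖(R * C)ᴴ * (G * C)‖ ≤ (s * q * (p + q) / c.σ) * (g * (s * q / c.σ)) := by
        refine (Matrix.l2_opNorm_mul _ _).trans ?_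
        rw [Matrix.l2_opNorm_conjTranspose]
        gcongr
      have hGR : ‖(G * C)ᴴ * (R * C)‖ ≤ (s * q * (p + q) / c.σ) * (g * (s * q / c.σ)) := by
        rw [← Matrix.l2_opNorm_conjTranspose, Matrix.conjTranspose_mul,
          Matrix.conjTranspose_conjTranspose]
        exact hRG
      have hGQ : ‖(G * C)ᴴ * Q * (G * C)‖
          ≤ (g * (s * q / c.σ)) * (c.P * κ + c.σ ^ 2) * (g * (s * q / c.σ)) := by
        refine (norm_mul₃_le _ _ _).trans ?_
        rw [Matrix.l2_opNorm_conjTranspose]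
        have hq2 := (norm_nonneg _).trans hQ
        gcongr
      rw [h1]
      calc _ ≤ γ * (2 * ((s * q * (p + q) / c.σ) * (g * (s * q / c.σ))))
            + γ ^ 2 * ((g * (s * q / c.σ)) * (c.P * κ + c.σ ^ 2) * (g * (s * q / c.σ))) := by
            refine (norm_add_le _ _).trans (add_le_add ?_ ?_)
            · rw [norm_real_smul, abs_neg, abs_of_nonneg hγ, two_mul]
              gcongr
              exact (norm_add_le _ _).trans (add_le_add hGR hRG)
            · rw [norm_real_smul, abs_of_nonneg (sq_nonneg _)]
              gcongr
        _ = Lc c.P κ c.σ a δ * γ ^ 2 + Ld c.P κ c.σ a δ * γ := by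
            rw [Lc, Ld, ← hg, ← hq, ← hpp, ← e2, ← e1]
            field_simp
            ring
        _ ≤ θ := hθ
    rw [hW] at h ⊢
    exact Adm.of_norm_sub_le hC hb (posSemidef_E hp.P_pos _ _ _).isHermitian
      (posSemidef_E hp.P_pos _ _ _).isHermitian key
  · have hWh : (x.W k)ᴴ = x.W k := h.posDef.isHermitian
    have hRW : rip G (R * x.W k) * (2 * c.α k) = rip G G := by
      nth_rewrite 3 [hG]
      rw [rip_smul_right, mul_comm]
    have h1 : (x.W k * (E c (stepU c γ x).U x.V k - E c x.U x.V k)).trace.re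
        = -γ * (2 * rip G (R * x.W k)) + γ ^ 2 * rip (G * C) (Q * (G * C)) := by
      have t1 : (x.W k * (Gᴴ * R)).trace.re = rip G (R * x.W k) := by
        rw [Matrix.trace_mul_comm, Matrix.mul_assoc, rip]
      have t2 : (x.W k * (Rᴴ * G)).trace.re = rip G (R * x.W k) := by
        rw [rip_comm, rip, Matrix.conjTranspose_mul, hWh, Matrix.mul_assoc]
      have t3 : (x.W k * (Gᴴ * (Q * G))).trace.re = rip (G * C) (Q * (G * C)) := by
        rw [hW, trace_mul_conjTranspose_self_mul, rip, Matrix.conjTranspose_mul]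
        simp only [Matrix.mul_assoc]
      rw [hdiff, Matrix.conjTranspose_smul, star_trivial]
      simp only [Matrix.mul_add, Matrix.smul_mul, Matrix.mul_smul, Matrix.trace_add,
        Matrix.trace_smul, Complex.add_re, Complex.smul_re, smul_eq_mul, Matrix.mul_assoc, t1, t2,
        t3]
      ring
    have h2 : rip (G * C) (Q * (G * C)) ≤ q ^ 2 * (rip G G * (s * q / c.σ) ^ 2) := by
      have hq2 := (norm_nonneg _).trans hQ
      rw [e2]
      refine (rip_mul_le (isHermitian_cov c x.V k) hQ _).trans ?_
      gcongr
      refine (rip_mul_self_le' _ _).trans ?_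
      have := rip_self_nonneg G
      gcongr
    have hGG := rip_self_nonneg G
    have h3 : γ * (2 * c.α k * (q ^ 2 * (s * q / c.σ) ^ 2)) ≤ 1 := by
      refine le_trans ?_ hL
      gcongr
      calc _ ≤ 2 * a * (q ^ 2 * (s * q / c.σ) ^ 2) := by gcongr
        _ = _ := by
          rw [Lu, ← e2, ← e1]
          field_simp
    rw [Matrix.mul_sub, Matrix.trace_sub, Complex.sub_re] at h1
    have h4 : c.α k * (γ ^ 2 * rip (G * C) (Q * (G * C)))
        ≤ c.α k * (γ ^ 2 * (q ^ 2 * (rip G G * (s * q / c.σ) ^ 2))) := by gcongr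
    have h5 : γ * rip G G * (γ * (2 * c.α k * (q ^ 2 * (s * q / c.σ) ^ 2)))
        ≤ γ * rip G G * 1 := by gcongr
    have h6 : 0 ≤ γ * rip G G := by positivity
    have h7 : c.α k * (x.W k * E c (stepU c γ x).U x.V k).trace.re
        = c.α k * (x.W k * E c x.U x.V k).trace.re - γ * rip G G
          + c.α k * (γ ^ 2 * rip (G * C) (Q * (G * C))) := by
      linear_combination c.α k * h1 - γ * hRW
    nlinarith

/-! ### The step on the beamformers -/

theorem rip_sum_right {m n ι : Type*} [Fintype m] [Fintype n] (s : Finset ι) (A : Matrix m n ℂ)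
    (f : ι → Matrix m n ℂ) : rip A (∑ i ∈ s, f i) = ∑ i ∈ s, rip A (f i) := by
  simp only [rip, Matrix.mul_sum, Matrix.trace_sum, Complex.re_sum]

/-- The Hessian of the signal part of the cost in each beamformer, up to a factor `2`:
`∑ₘ αₘ Hₘᴴ Uₘ Wₘ Uₘᴴ Hₘ`. -/
def signalHess (c : Downlink K M N d) (x : Vars K M N d) : Matrix (Fin M) (Fin M) ℂ :=
  ∑ m, c.α m • ((c.H m)ᴴ * x.U m * x.W m * (x.U m)ᴴ * c.H m)

/-- The coefficient `(σ² / P) ∑ₘ αₘ Tr (Wₘ Uₘᴴ Uₘ)` of `power V` in the cost. -/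
def noiseHess (c : Downlink K M N d) (x : Vars K M N d) : ℝ :=
  c.σ ^ 2 / c.P * ∑ m, c.α m * (x.W m * (x.U m)ᴴ * x.U m).trace.re

theorem gradV_eq (c : Downlink K M N d) (x : Vars K M N d) (k : Fin K) :
    gradV c x k = (2 : ℝ) • (signalHess c x * x.V k)
      - (2 * c.α k) • ((c.H k)ᴴ * x.U k * x.W k) + (2 * noiseHess c x) • x.V k := by
  simp only [gradV, signalHess, noiseHess, Matrix.sum_mul, Finset.smul_sum, Matrix.smul_mul,
    mul_smul]

theorem power_add (V D : Fin K → Matrix (Fin M) (Fin d) ℂ) :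
    power (fun k => V k + D k) = power V + (2 * ∑ m, rip (D m) (V m) + power D) := by
  simp only [power_eq, rip_add_left, rip_add_right, Finset.sum_add_distrib, Finset.mul_sum, two_mul,
    fun m => rip_comm (V m) (D m)]
  ring

theorem E_sub_of_beamformer (c : Downlink K M N d) (U : Fin K → Matrix (Fin N) (Fin d) ℂ)
    (V D : Fin K → Matrix (Fin M) (Fin d) ℂ) (k : Fin K) :
    E c U (fun j => V j + D j) k - E c U V k =
      -((U k)ᴴ * c.H k * D k) - ((U k)ᴴ * c.H k * D k)ᴴ
      + ∑ m, (U k)ᴴ * c.H k * (V m * (D m)ᴴ + D m * (V m)ᴴ + D m * (D m)ᴴ) * (c.H k)ᴴ * U k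
      + ((2 * ∑ m, rip (D m) (V m) + power D) / c.P * c.σ ^ 2) • ((U k)ᴴ * U k) := by
  rw [E_eq, E_eq, cov, cov, power_add, add_div, add_mul, add_smul]
  simp only [Matrix.sum_mul, Matrix.mul_sum, Matrix.conjTranspose_add, Matrix.conjTranspose_mul,
    Matrix.conjTranspose_conjTranspose, Matrix.add_mul, Matrix.mul_add, Matrix.mul_assoc,
    Finset.sum_add_distrib, Matrix.mul_smul, Matrix.smul_mul, Matrix.one_mul]
  abel

/-- The change of `E` under a perturbation of the beamformers of operator norm at most `t`. -/
theorem Params.norm_E_sub_le (hp : Params c κ a δ) {U : Fin K → Matrix (Fin N) (Fin d) ℂ}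
    {V D : Fin K → Matrix (Fin M) (Fin d) ℂ} (hV : power V = c.P) {k : Fin K}
    {C : Matrix (Fin d) (Fin d) ℂ} {t : ℝ} (ht : 0 ≤ t) (hD : ∀ m, ‖D m‖ ≤ t)
    (hUC : ‖U k * C‖ ≤ √δ / c.σ) (hC : ‖C‖ ≤ √δ * √(c.P * κ + c.σ ^ 2) / c.σ) :
    ‖Cᴴ * (E c U (fun j => V j + D j) k - E c U V k) * C‖ ≤
      2 * ((√δ / c.σ) * √κ * t * (√δ * √(c.P * κ + c.σ ^ 2) / c.σ))
      + K * ((√δ / c.σ) ^ 2 * κ * (2 * √c.P * t + t ^ 2))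
      + (2 * K * √c.P * √d * t + K * d * t ^ 2) / c.P * c.σ ^ 2 * (√δ / c.σ) ^ 2 := by
  have hσ := hp.σ_pos
  have hP := hp.P_pos
  have hκ := hp.κ_nonneg k
  set Z := U k * C with hZ
  have hsplit : Cᴴ * (E c U (fun j => V j + D j) k - E c U V k) * C =
      (-(Zᴴ * c.H k * (D k * C)) - (Zᴴ * c.H k * (D k * C))ᴴ)
      + ∑ m, (Zᴴ * c.H k) * (V m * (D m)ᴴ + D m * (V m)ᴴ + D m * (D m)ᴴ) * (Zᴴ * c.H k)ᴴ
      + ((2 * ∑ m, rip (D m) (V m) + power D) / c.P * c.σ ^ 2) • (Zᴴ * Z) := by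
    rw [E_sub_of_beamformer, hZ]
    simp only [Matrix.mul_sum, Matrix.sum_mul, Matrix.mul_add, Matrix.add_mul, Matrix.mul_sub,
      Matrix.sub_mul, Matrix.conjTranspose_mul, Matrix.conjTranspose_conjTranspose,
      Matrix.mul_smul, Matrix.smul_mul, Matrix.mul_assoc, Matrix.mul_neg, Matrix.neg_mul]
  have hZH : ‖Zᴴ * c.H k‖ ≤ (√δ / c.σ) * √κ := by
    refine (Matrix.l2_opNorm_mul _ _).trans ?_
    rw [Matrix.l2_opNorm_conjTranspose]
    exact mul_le_mul hUC (hp.norm_H_le k) (norm_nonneg _) (by positivity)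
  have h1 : ‖Zᴴ * c.H k * (D k * C)‖
      ≤ (√δ / c.σ) * √κ * t * (√δ * √(c.P * κ + c.σ ^ 2) / c.σ) := by
    rw [← Matrix.mul_assoc]
    refine (norm_mul₃_le _ _ _).trans ?_
    have := hD k
    gcongr
  have h2 : ∀ m, ‖(Zᴴ * c.H k) * (V m * (D m)ᴴ + D m * (V m)ᴴ + D m * (D m)ᴴ) * (Zᴴ * c.H k)ᴴ‖
      ≤ (√δ / c.σ) ^ 2 * κ * (2 * √c.P * t + t ^ 2) := by
    intro m
    have hm := hD m
    have hVm := norm_V_le hV m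
    have h3 : ‖V m * (D m)ᴴ + D m * (V m)ᴴ + D m * (D m)ᴴ‖ ≤ √c.P * t + t * √c.P + t * t := by
      refine (norm_add₃_le).trans ?_
      refine add_le_add (add_le_add ?_ ?_) ?_ <;> refine (Matrix.l2_opNorm_mul _ _).trans ?_ <;>
        rw [Matrix.l2_opNorm_conjTranspose] <;> gcongr
    refine (norm_mul₃_le _ _ _).trans ?_
    rw [Matrix.l2_opNorm_conjTranspose]
    calc _ ≤ ((√δ / c.σ) * √κ) * (√c.P * t + t * √c.P + t * t) * ((√δ / c.σ) * √κ) := by gcongr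
      _ = (√δ / c.σ) ^ 2 * √κ ^ 2 * (2 * √c.P * t + t ^ 2) := by ring
      _ = _ := by rw [Real.sq_sqrt hκ]
  -- The power is a Frobenius norm, whose square is at most `d` times the squared operator norm.
  have hDD : ∀ m, rip (D m) (D m) ≤ d * t ^ 2 := by
    intro m
    have h4 := rip_self_le_card_mul (D m)
    rw [Fintype.card_fin] at h4
    have hm := hD m
    exact h4.trans (by gcongr)
  have hDV : ∀ m, |rip (D m) (V m)| ≤ √c.P * √d * t := by
    intro m
    have h5 : rip (V m) (V m) ≤ c.P := by
      rw [← hV, power_eq]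
      exact Finset.single_le_sum (f := fun m => rip (V m) (V m)) (fun m _ => rip_self_nonneg _)
        (Finset.mem_univ m)
    calc _ ≤ √(rip (D m) (D m)) * √(rip (V m) (V m)) := rip_le _ _
      _ ≤ √(d * t ^ 2) * √c.P := by
          gcongr
          exact hDD m
      _ = √c.P * √d * t := by
          rw [Real.sqrt_mul (Nat.cast_nonneg d), Real.sqrt_sq ht]
          ring
  have h6 : |2 * ∑ m, rip (D m) (V m) + power D| ≤ 2 * K * √c.P * √d * t + K * d * t ^ 2 := by
    refine (abs_add_le _ _).trans (add_le_add ?_ ?_)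
    · rw [abs_mul, abs_two]
      calc _ ≤ 2 * ∑ m : Fin K, √c.P * √d * t := by
            gcongr
            exact (Finset.abs_sum_le_sum_abs _ _).trans (Finset.sum_le_sum fun m _ => hDV m)
        _ = _ := by
            rw [Finset.sum_const, Finset.card_univ, Fintype.card_fin, nsmul_eq_mul]
            ring
    · rw [abs_of_nonneg (power_nonneg _), power_eq]
      calc _ ≤ ∑ m : Fin K, d * t ^ 2 := Finset.sum_le_sum fun m _ => hDD m
        _ = _ := by
            rw [Finset.sum_const, Finset.card_univ, Fintype.card_fin, nsmul_eq_mul]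
            ring
  rw [hsplit]
  refine (norm_add₃_le).trans (add_le_add (add_le_add ?_ ?_) ?_)
  · refine (norm_sub_le _ _).trans ?_
    rw [norm_neg, Matrix.l2_opNorm_conjTranspose, two_mul]
    exact add_le_add h1 h1
  · refine (norm_sum_le_of_le _ fun m _ => h2 m).trans_eq ?_
    rw [Finset.sum_const, Finset.card_univ, Fintype.card_fin, nsmul_eq_mul]
  · rw [norm_real_smul, Matrix.l2_opNorm_conjTranspose_mul_self, ← sq, abs_mul, abs_div,
      abs_of_pos hP, abs_of_nonneg (sq_nonneg c.σ)]
    gcongr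

/-- The change of the trace part of the cost of user `k` under a perturbation of the
beamformers. -/
theorem trace_E_sub_of_beamformer (x : Vars K M N d) (D : Fin K → Matrix (Fin M) (Fin d) ℂ)
    (k : Fin K) (hW : (x.W k).IsHermitian) :
    (x.W k * (E c x.U (fun j => x.V j + D j) k - E c x.U x.V k)).trace.re =
      -2 * rip (D k) ((c.H k)ᴴ * x.U k * x.W k)
      + ∑ m, (2 * rip (D m) ((c.H k)ᴴ * x.U k * x.W k * (x.U k)ᴴ * c.H k * x.V m)
        + rip (D m) ((c.H k)ᴴ * x.U k * x.W k * (x.U k)ᴴ * c.H k * D m))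
      + (2 * ∑ m, rip (D m) (x.V m) + power D) / c.P * c.σ ^ 2
        * (x.W k * (x.U k)ᴴ * x.U k).trace.re := by
  have hW' : (x.W k)ᴴ = x.W k := hW
  have t0 : (x.W k * ((x.U k)ᴴ * c.H k * D k)).trace.re
      = rip (D k) ((c.H k)ᴴ * x.U k * x.W k) := by
    rw [rip_comm, rip]
    simp only [Matrix.conjTranspose_mul, Matrix.conjTranspose_conjTranspose, hW', Matrix.mul_assoc]
  have t1 : (x.W k * ((x.U k)ᴴ * c.H k * D k)ᴴ).trace.re
      = rip (D k) ((c.H k)ᴴ * x.U k * x.W k) := by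
    rw [Matrix.trace_mul_comm, rip]
    simp only [Matrix.conjTranspose_mul, Matrix.conjTranspose_conjTranspose, Matrix.mul_assoc]
  have t2 : ∀ A B : Matrix (Fin M) (Fin d) ℂ,
      (x.W k * ((x.U k)ᴴ * c.H k * (A * Bᴴ) * (c.H k)ᴴ * x.U k)).trace.re
        = rip B ((c.H k)ᴴ * x.U k * x.W k * (x.U k)ᴴ * c.H k * A) := by
    intro A B
    have e : x.W k * ((x.U k)ᴴ * c.H k * (A * Bᴴ) * (c.H k)ᴴ * x.U k)
        = (x.W k * (x.U k)ᴴ * c.H k * A) * (Bᴴ * ((c.H k)ᴴ * x.U k)) := by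
      simp only [Matrix.mul_assoc]
    rw [e, Matrix.trace_mul_comm, rip]
    simp only [Matrix.mul_assoc]
  have t3 : ∀ A B : Matrix (Fin M) (Fin d) ℂ,
      rip B ((c.H k)ᴴ * x.U k * x.W k * (x.U k)ᴴ * c.H k * A)
        = rip A ((c.H k)ᴴ * x.U k * x.W k * (x.U k)ᴴ * c.H k * B) := by
    intro A B
    rw [rip_comm, rip_mul_left]
    simp only [Matrix.conjTranspose_mul, Matrix.conjTranspose_conjTranspose, hW', Matrix.mul_assoc]
  have t4 : (x.W k * ((x.U k)ᴴ * x.U k)).trace.re = (x.W k * (x.U k)ᴴ * x.U k).trace.re := by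
    rw [Matrix.mul_assoc]
  have t5 : ∀ m, (x.W k * ((x.U k)ᴴ * c.H k * (x.V m * (D m)ᴴ + D m * (x.V m)ᴴ + D m * (D m)ᴴ)
      * (c.H k)ᴴ * x.U k)).trace.re
        = 2 * rip (D m) ((c.H k)ᴴ * x.U k * x.W k * (x.U k)ᴴ * c.H k * x.V m)
          + rip (D m) ((c.H k)ᴴ * x.U k * x.W k * (x.U k)ᴴ * c.H k * D m) := by
    intro m
    rw [Matrix.mul_add, Matrix.mul_add, Matrix.add_mul, Matrix.add_mul, Matrix.add_mul,
      Matrix.add_mul, Matrix.mul_add, Matrix.mul_add, Matrix.trace_add, Matrix.trace_add,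
      Complex.add_re, Complex.add_re, t2, t2, t2, t3 (D m) (x.V m), two_mul]
  rw [E_sub_of_beamformer, Matrix.mul_add, Matrix.mul_add, Matrix.mul_sub, Matrix.mul_neg,
    Matrix.mul_sum, Matrix.mul_smul, Matrix.trace_add, Matrix.trace_add, Matrix.trace_sub,
    Matrix.trace_neg, Matrix.trace_sum, Matrix.trace_smul, Complex.add_re, Complex.add_re,
    Complex.sub_re, Complex.neg_re, Complex.re_sum, Complex.smul_re, smul_eq_mul, t0, t1, t4,
    Finset.sum_congr rfl fun m _ => t5 m]
  ring

/-- The cost is a quadratic function of `V`: its change is the linear term given by `gradV` plus the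
quadratic terms given by `signalHess` and `noiseHess`. -/
theorem cost_sub_of_beamformer (x : Vars K M N d) (D : Fin K → Matrix (Fin M) (Fin d) ℂ)
    (hW : ∀ k, (x.W k).IsHermitian) :
    cost c { x with V := fun j => x.V j + D j } - cost c x =
      ∑ m, (rip (D m) (gradV c x m) + rip (D m) (signalHess c x * D m)
        + noiseHess c x * rip (D m) (D m)) := by
  have h1 : cost c { x with V := fun j => x.V j + D j } - cost c x =
      ∑ k, c.α k * (x.W k * (E c x.U (fun j => x.V j + D j) k - E c x.U x.V k)).trace.re := by
    rw [cost, cost, ← Finset.sum_sub_distrib]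
    refine Finset.sum_congr rfl fun k _ => ?_
    rw [Matrix.mul_sub, Matrix.trace_sub, Complex.sub_re]
    ring
  have hS : ∀ A B : Matrix (Fin M) (Fin d) ℂ, rip A (signalHess c x * B)
      = ∑ k, c.α k * rip A ((c.H k)ᴴ * x.U k * x.W k * (x.U k)ᴴ * c.H k * B) := by
    intro A B
    rw [signalHess, Matrix.sum_mul, rip_sum_right]
    refine Finset.sum_congr rfl fun k _ => ?_
    rw [Matrix.smul_mul, rip_smul_right]
  have hg : ∀ m, rip (D m) (gradV c x m) = 2 * rip (D m) (signalHess c x * x.V m)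
      - 2 * c.α m * rip (D m) ((c.H m)ᴴ * x.U m * x.W m)
      + 2 * noiseHess c x * rip (D m) (x.V m) := by
    intro m
    rw [gradV_eq, rip_add_right, sub_eq_add_neg, rip_add_right, ← neg_smul, rip_smul_right,
      rip_smul_right, rip_smul_right]
    ring
  have hn : ∑ k, c.α k * ((2 * ∑ m, rip (D m) (x.V m) + power D) / c.P * c.σ ^ 2
        * (x.W k * (x.U k)ᴴ * x.U k).trace.re)
      = noiseHess c x * (2 * ∑ m, rip (D m) (x.V m) + power D) := by
    generalize 2 * ∑ m, rip (D m) (x.V m) + power D = t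
    rw [noiseHess, Finset.mul_sum, Finset.sum_mul]
    exact Finset.sum_congr rfl fun k _ => by ring
  rw [h1, Finset.sum_congr rfl fun k _ => by rw [trace_E_sub_of_beamformer x D k (hW k)]]
  simp only [mul_add (c.α _), Finset.sum_add_distrib] at hn ⊢
  rw [hn]
  simp only [hg, hS, power_eq, Finset.sum_add_distrib, Finset.sum_sub_distrib, Finset.mul_sum,
    mul_add]
  have s1 : ∀ f : Fin K → Fin K → ℝ,
      ∑ k, ∑ m, c.α k * (2 * f k m) = ∑ m, ∑ k, 2 * (c.α k * f k m) := fun f => by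
    rw [Finset.sum_comm]
    exact Finset.sum_congr rfl fun m _ => Finset.sum_congr rfl fun k _ => by ring
  have s2 : ∑ k, c.α k * (-2 * rip (D k) ((c.H k)ᴴ * x.U k * x.W k))
      = -∑ k, 2 * c.α k * rip (D k) ((c.H k)ᴴ * x.U k * x.W k) := by
    rw [← Finset.sum_neg_distrib]
    exact Finset.sum_congr rfl fun k _ => by ring
  have s3 : ∑ m, noiseHess c x * (2 * rip (D m) (x.V m))
      = ∑ m, 2 * noiseHess c x * rip (D m) (x.V m) :=
    Finset.sum_congr rfl fun m _ => by ring
  rw [s1 fun k m => rip (D m) ((c.H k)ᴴ * x.U k * x.W k * (x.U k)ᴴ * c.H k * x.V m), s2, s3,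
    Finset.sum_comm (f := fun k m =>
      c.α k * rip (D m) ((c.H k)ᴴ * x.U k * x.W k * (x.U k)ᴴ * c.H k * D m))]
  ring

/-- The receivers seen in the coordinates in which the weights are the identity bound the Hessian
of the cost in the beamformers. -/
theorem Params.hess_bounds (hp : Params c κ a δ) (x : Vars K M N d)
    {C : Fin K → Matrix (Fin d) (Fin d) ℂ} (hW : ∀ k, x.W k = C k * (C k)ᴴ)
    (hUC : ∀ k, ‖x.U k * C k‖ ≤ √δ / c.σ) (k₀ : Fin K) :
    (signalHess c x).IsHermitian ∧ ‖signalHess c x‖ ≤ K * (a * (κ * (√δ / c.σ) ^ 2)) ∧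
      0 ≤ noiseHess c x ∧
      noiseHess c x ≤ c.σ ^ 2 / c.P * (K * (a * (d * (√δ / c.σ) ^ 2))) := by
  have hκ := hp.κ_nonneg k₀
  have ha := hp.a_nonneg k₀
  have hP := hp.P_pos
  have hT : ∀ k, (c.H k)ᴴ * x.U k * x.W k * (x.U k)ᴴ * c.H k
      = ((c.H k)ᴴ * (x.U k * C k)) * ((c.H k)ᴴ * (x.U k * C k))ᴴ := by
    intro k
    rw [hW]
    simp only [Matrix.conjTranspose_mul, Matrix.conjTranspose_conjTranspose, Matrix.mul_assoc]
  have hn : ∀ k, (x.W k * (x.U k)ᴴ * x.U k).trace.re = rip (x.U k * C k) (x.U k * C k) := by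
    intro k
    rw [hW, Matrix.mul_assoc, trace_mul_conjTranspose_self_mul, rip, Matrix.conjTranspose_mul]
    simp only [Matrix.mul_assoc]
  have hsq : ∀ k, ‖x.U k * C k‖ ^ 2 ≤ (√δ / c.σ) ^ 2 := fun k =>
    pow_le_pow_left₀ (norm_nonneg _) (hUC k) 2
  refine ⟨?_, ?_, ?_, ?_⟩
  · rw [Matrix.IsHermitian, signalHess, Matrix.conjTranspose_sum]
    refine Finset.sum_congr rfl fun k _ => ?_
    rw [Matrix.conjTranspose_smul, star_trivial, hT, Matrix.conjTranspose_mul,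
      Matrix.conjTranspose_conjTranspose]
  · rw [signalHess]
    refine (norm_sum_le_of_le (f := fun k => c.α k • ((c.H k)ᴴ * x.U k * x.W k * (x.U k)ᴴ * c.H k))
      (n := fun _ => a * (κ * (√δ / c.σ) ^ 2)) _ fun k _ => ?_).trans_eq ?_
    · rw [norm_real_smul, abs_of_nonneg (hp.α_nonneg k), hT, norm_self_mul_conjTranspose]
      refine mul_le_mul (hp.α_le k) ?_ (sq_nonneg _) ha
      calc _ ≤ (‖c.H k‖ * ‖x.U k * C k‖) ^ 2 := by
            gcongr
            refine (Matrix.l2_opNorm_mul _ _).trans ?_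
            rw [Matrix.l2_opNorm_conjTranspose]
        _ = ‖c.H k‖ ^ 2 * ‖x.U k * C k‖ ^ 2 := mul_pow _ _ _
        _ ≤ _ := mul_le_mul (hp.norm_H k) (hsq k) (sq_nonneg _) hκ
    · rw [Finset.sum_const, Finset.card_univ, Fintype.card_fin, nsmul_eq_mul]
  · refine mul_nonneg (by positivity) (Finset.sum_nonneg fun k _ => ?_)
    rw [hn]
    exact mul_nonneg (hp.α_nonneg k) (rip_self_nonneg _)
  · rw [noiseHess]
    gcongr
    calc _ ≤ ∑ k : Fin K, a * (d * (√δ / c.σ) ^ 2) := Finset.sum_le_sum fun k _ => ?_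
      _ = _ := by rw [Finset.sum_const, Finset.card_univ, Fintype.card_fin, nsmul_eq_mul]
    rw [hn]
    refine mul_le_mul (hp.α_le k) ?_ (rip_self_nonneg _) ha
    have h := rip_self_le_card_mul (x.U k * C k)
    rw [Fintype.card_fin] at h
    refine h.trans ?_
    have := hsq k
    gcongr

/-- `μv` bounds the operator norm of the gradient with respect to `V k`. -/
theorem Params.norm_gradV_le (hp : Params c κ a δ) {x : Vars K M N d} (hV : power x.V = c.P)
    {C : Fin K → Matrix (Fin d) (Fin d) ℂ} (hW : ∀ k, x.W k = C k * (C k)ᴴ)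
    (hUC : ∀ k, ‖x.U k * C k‖ ≤ √δ / c.σ)
    (hC : ∀ k, ‖C k‖ ≤ √δ * √(c.P * κ + c.σ ^ 2) / c.σ) (k : Fin K) :
    ‖gradV c x k‖ ≤ μv K d c.P κ c.σ a δ := by
  have hκ := hp.κ_nonneg k
  have ha := hp.a_nonneg k
  have hP := hp.P_pos
  have hσ := hp.σ_pos
  have hα := hp.α_nonneg k
  have hαa := hp.α_le k
  have hVk := norm_V_le hV k
  obtain ⟨-, hS, hn0, hn⟩ := hp.hess_bounds x hW hUC k
  have h1 : ‖(c.H k)ᴴ * x.U k * x.W k‖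
      ≤ √κ * (√δ / c.σ) * (√δ * √(c.P * κ + c.σ ^ 2) / c.σ) := by
    have e : (c.H k)ᴴ * x.U k * x.W k = (c.H k)ᴴ * (x.U k * C k) * (C k)ᴴ := by
      rw [hW]
      simp only [Matrix.mul_assoc]
    rw [e]
    refine (norm_mul₃_le _ _ _).trans ?_
    rw [Matrix.l2_opNorm_conjTranspose, Matrix.l2_opNorm_conjTranspose]
    have := hUC k
    have := hC k
    have := hp.norm_H_le k
    gcongr
  rw [gradV_eq]
  calc _ ≤ 2 * (K * (a * (κ * (√δ / c.σ) ^ 2)) * √c.P)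
        + 2 * a * (√κ * (√δ / c.σ) * (√δ * √(c.P * κ + c.σ ^ 2) / c.σ))
        + 2 * (c.σ ^ 2 / c.P * (K * (a * (d * (√δ / c.σ) ^ 2)))) * √c.P := by
        refine (norm_add_le _ _).trans (add_le_add ((norm_sub_le _ _).trans
          (add_le_add ?_ ?_)) ?_)
        · rw [norm_real_smul, abs_two]
          gcongr
          refine (Matrix.l2_opNorm_mul _ _).trans ?_
          gcongr
        · rw [norm_real_smul, abs_of_nonneg (by positivity)]
          gcongr
        · rw [norm_real_smul, abs_of_nonneg (by positivity)]
          gcongr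
    _ = _ := by
        have e1 := Real.sq_sqrt hp.δ_pos.le
        have e2 := Real.sq_sqrt hP.le
        have hw : 0 < √c.P := Real.sqrt_pos.2 hP
        rw [μv, (sqrt_consts hp k).2.2.2, Real.sqrt_mul hP.le κ]
        set w := √c.P
        set s := √δ
        rw [← e1, ← e2]
        field_simp

/-- One gradient step on `V`: the eigenvalues of all `W k E k` grow by at most `θ`, and the cost
does not increase. All beamformers move at once, and each of them enters every `E k`. -/
theorem Params.stepV_spec (hp : Params c κ a δ) {x : Vars K M N d} (hV : power x.V = c.P)
    {γ θ ρ : ℝ} (hγ : 0 ≤ γ) (hL : γ * Lv K d c.P κ c.σ a δ ≤ 1)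
    (hθ : La K d c.P κ c.σ a δ * γ ^ 2 + Lb K d c.P κ c.σ a δ * γ ≤ θ) (hρ : ρ ≤ δ)
    (h : ∀ k, Adm ρ (x.W k) (E c x.U x.V k)) :
    (∀ k, Adm (ρ + θ) (x.W k) (E c x.U (stepV c γ x).V k)) ∧
      cost c (stepV c γ x) ≤ cost c x := by
  have hσ := hp.σ_pos
  have hP := hp.P_pos
  choose C hC hW hb using fun k => (h k).exists_factor
  have hb' : ∀ k,
      (δ • (1 : Matrix (Fin d) (Fin d) ℂ) - (C k)ᴴ * E c x.U x.V k * C k).PosSemidef := by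
    intro k
    convert (hb k).add (Matrix.PosSemidef.one.smul (sub_nonneg.2 hρ)) using 1
    rw [sub_smul]
    abel
  have hUC := fun k => (hp.factor_bounds hV (hb' k)).1
  have hCn := fun k => (hp.factor_bounds hV (hb' k)).2
  set G := gradV c x with hG
  have hstep : (stepV c γ x).V = fun j => x.V j + (-γ) • G j := by
    funext j
    rw [neg_smul, ← sub_eq_add_neg]
    rfl
  constructor
  · intro k
    have hκ := hp.κ_nonneg k
    set g := μv K d c.P κ c.σ a δ with hg
    have hGn : ∀ j, ‖G j‖ ≤ g := hp.norm_gradV_le hV hW hUC hCn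
    have hg0 : 0 ≤ g := (norm_nonneg _).trans (hGn k)
    have key := hp.norm_E_sub_le (D := fun j => (-γ) • G j) (t := γ * g) hV (by positivity)
      (fun j => by
        rw [norm_real_smul, abs_neg, abs_of_nonneg hγ]
        exact mul_le_mul_of_nonneg_left (hGn j) hγ) (hUC k) (hCn k)
    rw [← hstep] at key
    rw [hW]
    refine Adm.of_norm_sub_le (hC k) (hb k) (posSemidef_E hP _ _ _).isHermitian
      (posSemidef_E hP _ _ _).isHermitian (key.trans (le_trans (le_of_eq ?_) hθ))
    have e1 := Real.sq_sqrt hp.δ_pos.le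
    rw [La, Lb, ← hg, Real.sqrt_mul hκ]
    set s := √δ
    rw [← e1]
    field_simp
    ring
  · rcases isEmpty_or_nonempty (Fin K) with hK | ⟨⟨k₀⟩⟩
    · simp [cost]
    obtain ⟨hS, hSn, hn0, hn⟩ := hp.hess_bounds x hW hUC k₀
    have h1 := cost_sub_of_beamformer (c := c) x (fun j => (-γ) • G j)
      fun k => (h k).posDef.isHermitian
    have h2 : cost c { x with V := fun j => x.V j + (-γ) • G j } = cost c (stepV c γ x) := by
      rw [← hstep]
      rfl
    rw [h2] at h1
    rw [← sub_nonpos, h1]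
    refine Finset.sum_nonpos fun m _ => ?_
    have h3 := rip_mul_le hS hSn (G m)
    have h4 := rip_self_nonneg (G m)
    have h5 : γ * (K * (a * (κ * (√δ / c.σ) ^ 2)) + noiseHess c x) ≤ 1 := by
      refine le_trans ?_ hL
      gcongr
      have e1 := Real.sq_sqrt hp.δ_pos.le
      calc _ ≤ 2 * (K * (a * (κ * (√δ / c.σ) ^ 2))
            + c.σ ^ 2 / c.P * (K * (a * (d * (√δ / c.σ) ^ 2)))) := by
            have h6 := (norm_nonneg _).trans hSn
            have h7 := hn0.trans hn
            linarith
        _ = _ := by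
            rw [Lv, div_pow, e1]
            field_simp
    have h6 : γ * rip (G m) (G m) * (γ * (K * (a * (κ * (√δ / c.σ) ^ 2)) + noiseHess c x))
        ≤ γ * rip (G m) (G m) * 1 := by gcongr
    have h7 : γ ^ 2 * rip (G m) (signalHess c x * G m)
        ≤ γ ^ 2 * (K * (a * (κ * (√δ / c.σ) ^ 2)) * rip (G m) (G m)) := by gcongr
    rw [Matrix.mul_smul]
    simp only [rip_smul_left, rip_smul_right]
    rw [← hG]
    nlinarith

/-! ### The rescaling and the degenerate state -/

theorem E_of_V_eq_zero (c : Downlink K M N d) (U : Fin K → Matrix (Fin N) (Fin d) ℂ) (k : Fin K) :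
    E c U 0 k = 1 := by
  simp [E, power_eq_zero.2 rfl]

theorem E_of_U_eq_zero (c : Downlink K M N d) (V : Fin K → Matrix (Fin M) (Fin d) ℂ) (k : Fin K) :
    E c 0 V k = 1 := by
  simp [E]

/-- The reciprocal scaling leaves `Uₖᴴ Hₖ Vₘ` and `power V • Uₖᴴ Uₖ` unchanged. -/
theorem E_smul (c : Downlink K M N d) (U : Fin K → Matrix (Fin N) (Fin d) ℂ)
    (V : Fin K → Matrix (Fin M) (Fin d) ℂ) (k : Fin K) {b : ℝ} (hb : b ≠ 0) :
    E c (fun j => (1 / b) • U j) (fun j => b • V j) k = E c U V k := by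
  have h1 : 1 / b * b = 1 := one_div_mul_cancel hb
  have h2 : b * (1 / b) = 1 := mul_one_div_cancel hb
  have h3 : b ^ 2 * power V / c.P * c.σ ^ 2 * (1 / b * (1 / b)) = power V / c.P * c.σ ^ 2 := by
    field_simp
  rw [E, E, power_smul]
  simp only [Matrix.conjTranspose_smul, star_trivial, Matrix.smul_mul, Matrix.mul_smul, smul_smul,
    h1, h2, h3, one_smul]

/-- The scale factor vanishes exactly for `V = 0`, where it is `√(P / 0)` with the convention
`P / 0 = 0`; otherwise it restores the power `P`. -/
theorem scaleFactor_eq_zero_or {c : Downlink K M N d} (hP : 0 < c.P) (x : Vars K M N d) :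
    x.V = 0 ∧ scaleFactor c x = 0 ∨
      0 < scaleFactor c x ∧ scaleFactor c x ^ 2 * power x.V = c.P := by
  rcases (power_nonneg x.V).eq_or_lt with h | h
  · left
    exact ⟨power_eq_zero.1 h.symm, by simp [scaleFactor, ← h]⟩
  · right
    have h1 : 0 < c.P / power x.V := div_pos hP h
    refine ⟨Real.sqrt_pos.2 h1, ?_⟩
    rw [scaleFactor, Real.sq_sqrt h1.le, div_mul_cancel₀ _ h.ne']

theorem E_rescale {c : Downlink K M N d} (hP : 0 < c.P) (x : Vars K M N d) (k : Fin K) :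
    E c (rescale c x).U (rescale c x).V k = E c x.U x.V k := by
  rcases scaleFactor_eq_zero_or hP x with ⟨h0, h⟩ | ⟨h, -⟩
  · have h1 : (rescale c x).V = 0 := by
      funext j
      simp [rescale, h]
    rw [h1, h0, E_of_V_eq_zero, E_of_V_eq_zero]
  · exact E_smul c x.U x.V k h.ne'

theorem cost_rescale {c : Downlink K M N d} (hP : 0 < c.P) (x : Vars K M N d) :
    cost c (rescale c x) = cost c x := by
  simp only [cost, E_rescale hP]
  rfl

/-- The beamformers use the full power, or else the receivers and the beamformers all vanish. -/
def Normalized (c : Downlink K M N d) (x : Vars K M N d) : Prop :=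
  power x.V = c.P ∨ x.U = 0 ∧ x.V = 0

theorem normalized_rescale {c : Downlink K M N d} (hP : 0 < c.P) (x : Vars K M N d) :
    Normalized c (rescale c x) := by
  rcases scaleFactor_eq_zero_or hP x with ⟨-, h⟩ | ⟨-, h⟩
  · right
    constructor <;> funext j <;> simp [rescale, h]
  · left
    rw [← h, ← power_smul]
    rfl

theorem stepU_of_eq_zero {x : Vars K M N d} (c : Downlink K M N d) (γ : ℝ) (hU : x.U = 0)
    (hV : x.V = 0) : stepU c γ x = x := by
  ext1
  · funext k
    simp [stepU, gradU, hU, hV, power_eq_zero.2 rfl]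
  · rfl
  · rfl

theorem stepV_of_eq_zero {x : Vars K M N d} (c : Downlink K M N d) (γ : ℝ) (hU : x.U = 0)
    (hV : x.V = 0) : stepV c γ x = x := by
  ext1
  · rfl
  · rfl
  · funext k
    simp [stepV, gradV, hU, hV]

/-! ### The invariant of the algorithm -/

variable {s : Schedule} {θ ρ : ℝ} {x : Vars K M N d}

/-- The invariant: the state is normalized and the eigenvalues of `W k E k` are at most `ρ`. -/
structure Inv (c : Downlink K M N d) (ρ : ℝ) (x : Vars K M N d) : Prop where
  normalized : Normalized c x
  adm : ∀ k, Adm ρ (x.W k) (E c x.U x.V k)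

theorem Inv.mono {ρ' : ℝ} (h : Inv c ρ x) (hρ : ρ ≤ ρ') : Inv c ρ' x :=
  ⟨h.normalized, fun k => (h.adm k).mono hρ⟩

/-- The consequences of the step size conditions that the steps use: descent, and a drift of the
eigenvalues of `W k E k` by at most `θ`. -/
structure StepBounds (c : Downlink K M N d) (s : Schedule) (κ a δ θ : ℝ) : Prop where
  θ_nonneg : 0 ≤ θ
  γu_nonneg : 0 ≤ s.γu
  γv_nonneg : 0 ≤ s.γv
  descentU : s.γu * Lu c.P κ c.σ a δ ≤ 1
  descentV : s.γv * Lv K d c.P κ c.σ a δ ≤ 1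
  driftU : Lc c.P κ c.σ a δ * s.γu ^ 2 + Ld c.P κ c.σ a δ * s.γu ≤ θ
  driftV : La K d c.P κ c.σ a δ * s.γv ^ 2 + Lb K d c.P κ c.σ a δ * s.γv ≤ θ

/-- In the degenerate state the step on `U` does nothing; otherwise the power is `P` and
`Params.stepU_user` applies. -/
theorem Inv.stepU (h : Inv c ρ x) (hp : Params c κ a δ) (hs : StepBounds c s κ a δ θ)
    (hρ : ρ ≤ δ) :
    Inv c (ρ + θ) (stepU c s.γu x) ∧ cost c (WMMSE.stepU c s.γu x) ≤ cost c x := by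
  rcases h.normalized with hV | ⟨hU, hV⟩
  · have key := fun k => hp.stepU_user hV hs.γu_nonneg hs.descentU hs.driftU hρ (h.adm k)
    refine ⟨⟨Or.inl hV, fun k => (key k).1⟩, Finset.sum_le_sum fun k _ => ?_⟩
    rw [mul_sub, mul_sub]
    exact sub_le_sub_right (key k).2 _
  · rw [stepU_of_eq_zero c s.γu hU hV]
    exact ⟨h.mono (by linarith [hs.θ_nonneg]), le_rfl⟩

theorem Inv.stepW (h : Inv c ρ x) (hp : Params c κ a δ) (hρ : ρ ≤ δ) :
    Inv c 1 (stepW c x) ∧ cost c (WMMSE.stepW c x) ≤ cost c x := by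
  refine ⟨⟨h.normalized, fun k => ?_⟩, Finset.sum_le_sum fun k _ => ?_⟩
  · exact (h.adm k).schulz (posSemidef_E hp.P_pos _ _ _).isHermitian (hρ.trans_lt hp.δ_lt_two)
  · exact mul_le_mul_of_nonneg_left ((h.adm k).schulz_cost_le (posSemidef_E hp.P_pos _ _ _)
      hp.one_lt_δ hp.δ_lt_two hp.δ_eq hρ) (hp.α_nonneg k)

theorem Inv.stepV (h : Inv c ρ x) (hp : Params c κ a δ) (hs : StepBounds c s κ a δ θ)
    (hρ : ρ ≤ δ) :
    Inv c (ρ + θ) (rescale c (stepV c s.γv x)) ∧ cost c (WMMSE.stepV c s.γv x) ≤ cost c x := by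
  have key : (∀ k, Adm (ρ + θ) (x.W k) (E c x.U (WMMSE.stepV c s.γv x).V k)) ∧
      cost c (WMMSE.stepV c s.γv x) ≤ cost c x := by
    rcases h.normalized with hV | ⟨hU, hV⟩
    · exact hp.stepV_spec hV hs.γv_nonneg hs.descentV hs.driftV hρ h.adm
    · rw [stepV_of_eq_zero c s.γv hU hV]
      exact ⟨fun k => (h.adm k).mono (by linarith [hs.θ_nonneg]), le_rfl⟩
  refine ⟨⟨normalized_rescale hp.P_pos _, fun k => ?_⟩, key.2⟩
  rw [E_rescale hp.P_pos]
  exact key.1 k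

theorem inv_init (V₀ : Fin K → Matrix (Fin M) (Fin d) ℂ) (hV₀ : power V₀ = c.P) :
    Inv c 1 (init V₀ : Vars K M N d) := by
  refine ⟨Or.inl hV₀, fun k => ?_⟩
  have h : E c (init V₀ : Vars K M N d).U (init V₀ : Vars K M N d).V k = 1 :=
    E_of_U_eq_zero c V₀ k
  rw [h]
  refine ⟨Matrix.PosDef.one, ?_⟩
  simpa [init] using Matrix.PosSemidef.zero

theorem phaseU_succ (c : Downlink K M N d) (s : Schedule) (x : Vars K M N d) (j : ℕ) :
    phaseU c s x (j + 1) = stepU c s.γu (phaseU c s x j) :=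
  Function.iterate_succ_apply' _ _ _

theorem phaseW_succ (c : Downlink K M N d) (s : Schedule) (x : Vars K M N d) (j : ℕ) :
    phaseW c s x (j + 1) = stepW c (phaseW c s x j) :=
  Function.iterate_succ_apply' _ _ _

theorem phaseV_succ (c : Downlink K M N d) (s : Schedule) (x : Vars K M N d) (j : ℕ) :
    phaseV c s x (j + 1) = rescale c (stepV c s.γv (phaseV c s x j)) :=
  Function.iterate_succ_apply' _ _ _

theorem Inv.phaseU (h : Inv c ρ x) (hp : Params c κ a δ) (hs : StepBounds c s κ a δ θ)
    (hρ : ρ + s.Ju * θ ≤ δ) :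
    ∀ j, j ≤ s.Ju → Inv c (ρ + j * θ) (phaseU c s x j) := by
  intro j
  induction j with
  | zero =>
    intro _
    simpa [WMMSE.phaseU] using h
  | succ j ih =>
    intro hj
    have hj' : (j : ℝ) * θ ≤ s.Ju * θ :=
      mul_le_mul_of_nonneg_right (by exact_mod_cast (Nat.le_succ j).trans hj) hs.θ_nonneg
    have h1 := ((ih (Nat.le_of_succ_le hj)).stepU hp hs (by linarith)).1
    rw [phaseU_succ]
    convert h1 using 1
    push_cast
    ring

/-- The bound before the first Schulz iteration is `δ`, and it is `1` after every one. -/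
theorem Inv.phaseW (h : Inv c ρ x) (hp : Params c κ a δ) (hs : StepBounds c s κ a δ θ)
    (hρ : ρ + s.Ju * θ ≤ δ) (j : ℕ) :
    Inv c δ (phaseW c s x j) ∧ Inv c 1 (phaseW c s x (j + 1)) := by
  induction j with
  | zero =>
    have h0 : Inv c δ (WMMSE.phaseW c s x 0) := (h.phaseU hp hs hρ s.Ju le_rfl).mono hρ
    exact ⟨h0, (h0.stepW hp le_rfl).1⟩
  | succ j ih =>
    have h1 := ih.2.mono hp.one_lt_δ.le
    refine ⟨h1, ?_⟩
    rw [phaseW_succ]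
    exact (h1.stepW hp le_rfl).1

theorem Inv.phaseV (h : Inv c ρ x) (hp : Params c κ a δ) (hs : StepBounds c s κ a δ θ)
    (hρ : ρ + s.Ju * θ ≤ δ) (hJw : 1 ≤ s.Jw) (hθ : 1 + s.Jv * θ ≤ δ) :
    ∀ j, j ≤ s.Jv → Inv c (1 + j * θ) (phaseV c s x j) := by
  intro j
  induction j with
  | zero =>
    intro _
    obtain ⟨i, hi⟩ := Nat.exists_eq_add_of_le' hJw
    have h1 := (h.phaseW hp hs hρ i).2
    rw [← hi] at h1
    simpa [WMMSE.phaseV] using h1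
  | succ j ih =>
    intro hj
    have hj' : (j : ℝ) * θ ≤ s.Jv * θ :=
      mul_le_mul_of_nonneg_right (by exact_mod_cast (Nat.le_succ j).trans hj) hs.θ_nonneg
    have h1 := ((ih (Nat.le_of_succ_le hj)).stepV hp hs (by linarith)).1
    rw [phaseV_succ]
    convert h1 using 1
    push_cast
    ring

/-- At the start of every outer iteration the eigenvalues of `W k E k` are at most `1 + Jv θ`:
the Schulz iterations reset the bound to `1`, and `Jv` steps on `V` have followed them. -/
theorem inv_iterate (hp : Params c κ a δ) (hs : StepBounds c s κ a δ θ) (hJw : 1 ≤ s.Jw)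
    (hθ : 1 + s.Jv * θ + s.Ju * θ ≤ δ) {V₀ : Fin K → Matrix (Fin M) (Fin d) ℂ}
    (hV₀ : power V₀ = c.P) (l : ℕ) : Inv c (1 + s.Jv * θ) (iterate c s V₀ l) := by
  have hu : 0 ≤ s.Ju * θ := mul_nonneg (Nat.cast_nonneg _) hs.θ_nonneg
  have hv : 0 ≤ s.Jv * θ := mul_nonneg (Nat.cast_nonneg _) hs.θ_nonneg
  induction l with
  | zero => exact (inv_init V₀ hV₀).mono (by linarith)
  | succ l ih => exact ih.phaseV hp hs hθ hJw (by linarith) s.Jv le_rfl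

/-! ### The step sizes -/

theorem mul_le_one_of_le_one_div {γ L : ℝ} (hγ : 0 < γ) (h : γ ≤ 1 / L) : γ * L ≤ 1 := by
  have hL : 0 < L := one_div_pos.1 (hγ.trans_le h)
  rwa [le_div_iff₀ hL] at h

/-- A positive number up to the positive root of `A t² + B t = θ`. If `A = 0`, the formula for the
root has the value `0`, and no positive `γ` satisfies the hypothesis. -/
theorem quadratic_le_of_le_root {A B θ γ : ℝ} (hγ : 0 < γ) (hA : 0 ≤ A) (hB : 0 ≤ B) (hθ : 0 ≤ θ)
    (h : γ ≤ (-B + √(B ^ 2 + 4 * A * θ)) / (2 * A)) : A * γ ^ 2 + B * γ ≤ θ := by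
  rcases hA.eq_or_lt with rfl | hA
  · simp at h
    linarith
  rw [le_div_iff₀ (by positivity)] at h
  have h1 : (γ * (2 * A) + B) ^ 2 ≤ B ^ 2 + 4 * A * θ := by
    rw [← Real.le_sqrt (by positivity) (by positivity)]
    linarith
  nlinarith

theorem stepBounds (hp : Params c κ a δ) (k : Fin K) (hγu : 0 < s.γu)
    (hγu_le : s.γu ≤ min (1 / Lu c.P κ c.σ a δ) (νu (s.Ju + s.Jv) c.P κ c.σ a δ))
    (hγv : 0 < s.γv)
    (hγv_le : s.γv ≤ min (1 / Lv K d c.P κ c.σ a δ) (νv (s.Ju + s.Jv) K d c.P κ c.σ a δ)) :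
    StepBounds c s κ a δ ((δ - 1) / (s.Ju + s.Jv : ℕ)) := by
  have hP := hp.P_pos
  have hσ := hp.σ_pos
  have hδ := hp.δ_pos
  have hκ := hp.κ_nonneg k
  have ha := hp.a_nonneg k
  have hμu : 0 ≤ μu c.P κ c.σ a δ := by
    unfold μu
    positivity
  have hμv : 0 ≤ μv K d c.P κ c.σ a δ := by
    unfold μv
    positivity
  have hθ : 0 ≤ (δ - 1) / (s.Ju + s.Jv : ℕ) :=
    div_nonneg (by linarith [hp.one_lt_δ]) (Nat.cast_nonneg _)
  refine ⟨hθ, hγu.le, hγv.le, mul_le_one_of_le_one_div hγu (hγu_le.trans (min_le_left _ _)),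
    mul_le_one_of_le_one_div hγv (hγv_le.trans (min_le_left _ _)),
    quadratic_le_of_le_root hγu ?_ ?_ hθ (hγu_le.trans (min_le_right _ _)),
    quadratic_le_of_le_root hγv ?_ ?_ hθ (hγv_le.trans (min_le_right _ _))⟩
  · unfold Lc
    positivity
  · unfold Ld
    positivity
  · unfold La
    positivity
  · unfold Lb
    positivity

/-- The cost drops in every single step of an outer iteration that starts within the invariant. -/
theorem Inv.cost_steps (h : Inv c ρ x) (hp : Params c κ a δ) (hs : StepBounds c s κ a δ θ)
    (hρ : ρ + s.Ju * θ ≤ δ) (hJw : 1 ≤ s.Jw) (hθ : 1 + s.Jv * θ ≤ δ) :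
    (∀ j, j < s.Ju → cost c (WMMSE.phaseU c s x (j + 1)) ≤ cost c (WMMSE.phaseU c s x j)) ∧
    (∀ j, cost c (WMMSE.phaseW c s x (j + 1)) ≤ cost c (WMMSE.phaseW c s x j)) ∧
    (∀ j, j < s.Jv →
      cost c (WMMSE.stepV c s.γv (WMMSE.phaseV c s x j)) ≤ cost c (WMMSE.phaseV c s x j)) := by
  refine ⟨fun j hj => ?_, fun j => ?_, fun j hj => ?_⟩
  · have hj' : (j : ℝ) * θ ≤ s.Ju * θ :=
      mul_le_mul_of_nonneg_right (by exact_mod_cast hj.le) hs.θ_nonneg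
    rw [phaseU_succ]
    exact ((h.phaseU hp hs hρ j hj.le).stepU hp hs (by linarith)).2
  · rw [phaseW_succ]
    exact ((h.phaseW hp hs hρ j).1.stepW hp le_rfl).2
  · have hj' : (j : ℝ) * θ ≤ s.Jv * θ :=
      mul_le_mul_of_nonneg_right (by exact_mod_cast hj.le) hs.θ_nonneg
    exact ((h.phaseV hp hs hρ hJw hθ j hj.le).stepV hp hs (by linarith)).2

end WMMSE

end

theorem theorem1 {K M N d : ℕ} (c : WMMSE.Downlink K M N d) (s : WMMSE.Schedule)
    (V₀ : Fin K → Matrix (Fin M) (Fin d) ℂ) (κ a δ : ℝ)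
    (hP : 0 < c.P) (hσ : 0 < c.σ)
    (hκ : ∀ k, ‖c.H k‖ ^ 2 ≤ κ)
    (hα : ∀ k, 0 ≤ c.α k) (ha : ∀ k, c.α k ≤ a)
    (hδ1 : 1 < δ) (hδ2 : δ < 2) (hδ : δ - δ ^ 2 - Real.log (2 - δ) = 0)
    (hJu : 1 ≤ s.Ju) (hJw : 1 ≤ s.Jw) (hJv : 1 ≤ s.Jv)
    (hV₀ : WMMSE.power V₀ = c.P)
    (hγu : 0 < s.γu)
    (hγu_le : s.γu ≤ min (1 / WMMSE.Lu c.P κ c.σ a δ) (WMMSE.νu (s.Ju + s.Jv) c.P κ c.σ a δ))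
    (hγv : 0 < s.γv)
    (hγv_le : s.γv ≤
      min (1 / WMMSE.Lv K d c.P κ c.σ a δ) (WMMSE.νv (s.Ju + s.Jv) K d c.P κ c.σ a δ)) :
    -- the weights stay positive definite, so that the cost is well defined at every step
    (∀ l j, j ≤ s.Jw → ∀ k,
      ((WMMSE.phaseW c s (WMMSE.iterate c s V₀ l) j).W k).PosDef) ∧
    -- the cost is non-increasing along the outer iterations
    Antitone (fun l => WMMSE.cost c (WMMSE.iterate c s V₀ l)) ∧
    -- the cost is non-increasing in every single step on `U`
    (∀ l j, j < s.Ju →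
      WMMSE.cost c (WMMSE.phaseU c s (WMMSE.iterate c s V₀ l) (j + 1)) ≤
        WMMSE.cost c (WMMSE.phaseU c s (WMMSE.iterate c s V₀ l) j)) ∧
    -- the cost is non-increasing in every single step on `W`
    (∀ l j, j < s.Jw →
      WMMSE.cost c (WMMSE.phaseW c s (WMMSE.iterate c s V₀ l) (j + 1)) ≤
        WMMSE.cost c (WMMSE.phaseW c s (WMMSE.iterate c s V₀ l) j)) ∧
    -- the cost is non-increasing in every single step on `V`, before and after the rescaling
    (∀ l j, j < s.Jv →
      WMMSE.cost c (WMMSE.stepV c s.γv (WMMSE.phaseV c s (WMMSE.iterate c s V₀ l) j)) ≤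
          WMMSE.cost c (WMMSE.phaseV c s (WMMSE.iterate c s V₀ l) j) ∧
        WMMSE.cost c (WMMSE.phaseV c s (WMMSE.iterate c s V₀ l) (j + 1)) ≤
          WMMSE.cost c (WMMSE.stepV c s.γv (WMMSE.phaseV c s (WMMSE.iterate c s V₀ l) j))) := by
  have hp : WMMSE.Params c κ a δ := ⟨hP, hσ, hκ, hα, ha, hδ1, hδ2, hδ⟩
  rcases isEmpty_or_nonempty (Fin K) with hK | ⟨⟨k₀⟩⟩
  -- Without users, `κ` and `a` may be negative, but the cost is an empty sum.
  · have h0 : ∀ x : WMMSE.Vars K M N d, WMMSE.cost c x = 0 := fun x => by simp [WMMSE.cost]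
    simp only [h0]
    exact ⟨fun _ _ _ k => hK.elim k, fun _ _ _ => le_rfl, fun _ _ _ => le_rfl,
      fun _ _ _ => le_rfl, fun _ _ _ => ⟨le_rfl, le_rfl⟩⟩
  have hs := WMMSE.stepBounds hp k₀ hγu hγu_le hγv hγv_le
  set θ := (δ - 1) / (s.Ju + s.Jv : ℕ)
  have hθ : 1 + s.Jv * θ + s.Ju * θ ≤ δ := by
    have hJ : ((s.Ju + s.Jv : ℕ) : ℝ) ≠ 0 := by
      have : s.Ju + s.Jv ≠ 0 := by omega
      exact_mod_cast this
    have h1 : ((s.Ju + s.Jv : ℕ) : ℝ) * θ = δ - 1 := mul_div_cancel₀ _ hJ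
    push_cast at h1
    linarith
  have hu : 0 ≤ s.Ju * θ := mul_nonneg (Nat.cast_nonneg _) hs.θ_nonneg
  have hinv := WMMSE.inv_iterate hp hs hJw hθ hV₀
  have hcost := fun l => (hinv l).cost_steps hp hs hθ hJw (by linarith)
  have hresc : ∀ x j, WMMSE.cost c (WMMSE.phaseV c s x (j + 1))
      ≤ WMMSE.cost c (WMMSE.stepV c s.γv (WMMSE.phaseV c s x j)) := fun x j => by
    rw [WMMSE.phaseV_succ, WMMSE.cost_rescale hP]
  refine ⟨fun l j _ k => (((hinv l).phaseW hp hs hθ j).1.adm k).posDef,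
    antitone_nat_of_succ_le fun l => ?_, fun l j hj => (hcost l).1 j hj,
    fun l j _ => (hcost l).2.1 j, fun l j hj => ⟨(hcost l).2.2 j hj, hresc _ _⟩⟩
  set x := WMMSE.iterate c s V₀ l
  have hU : ∀ j, j ≤ s.Ju → WMMSE.cost c (WMMSE.phaseU c s x j) ≤ WMMSE.cost c x := by
    intro j
    induction j with
    | zero => exact fun _ => le_rfl
    | succ j ih => exact fun hj => ((hcost l).1 j hj).trans (ih (Nat.le_of_succ_le hj))
  have hW : ∀ j, WMMSE.cost c (WMMSE.phaseW c s x j) ≤ WMMSE.cost c x := by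
    intro j
    induction j with
    | zero => exact hU s.Ju le_rfl
    | succ j ih => exact ((hcost l).2.1 j).trans ih
  have hV : ∀ j, j ≤ s.Jv → WMMSE.cost c (WMMSE.phaseV c s x j) ≤ WMMSE.cost c x := by
    intro j
    induction j with
    | zero => exact fun _ => hW s.Jw
    | succ j ih =>
      exact fun hj => (hresc x j).trans (((hcost l).2.2 j hj).trans (ih (Nat.le_of_succ_le hj)))
  exact hV s.Jv le_rfl
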